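/- Let $m_1,\dots,m_r$ and $n_1,\dots,n_s$ be non-negative integers (with $M_0=0$) such that $\sum_i m_i=\sum_j n_j=N$, and let $P=\bigoplus_{i=1}^r M_{m_i}(\mathbb C)$ and $Q=\bigoplus_{j=1}^s M_{n_j}(\mathbb C)$. Enumerate the $N$ diagonal matrix units of $P$, and likewise those of $Q$, by $1,\dots,N$ in any way, and embed $\mathbb C^N$ as the diagonal matrices in $P$ and in $Q$ accordingly: the $e$-th standard basis vector goes to the $e$-th diagonal matrix unit. (For instance, the diagonals may be enumerated summand by summand, from left to right.) Let $\Gamma$ be the bipartite multigraph with one vertex for each of the $r+s$ summands of $P$ and $Q$, and one edge for each $e\in\{1,\dots,N\}$, which joins the summand of $P$ containing the $e$-th diagonal matrix unit of $P$ to the summand of $Q$ containing the $e$-th diagonal matrix unit of $Q$. Let $W_1,\dots,W_p$ be the connected components of $\Gamma$. Let $k_i$ be the number of edges of $W_i$ (parallel edges counted separately), and let $q_i$ be the number of edges of $W_i$ left over after removing a spanning tree of $W_i$, that is, its cycle rank; a spanning tree always exists and may be chosen arbitrarily. Then the free product $P *_{\mathbb C^N} Q$ with amalgamation over $\mathbb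 C^N$, in the category of (not necessarily unital) $C^*$-algebras and $*$-homomorphisms, exists, and $$P *_{\mathbb C^N} Q\;\cong\;\bigoplus_{i=1}^p M_{k_i}\bigl(C^*(F_{q_i})\bigr).$$ More explicitly, there are $*$-homomorphisms of $P$ and $Q$ into the right-hand side that agree on $\mathbb C^N$ and are universal among such pairs of $*$-homomorphisms into a $C^*$-algebra; and every $C^*$-algebra with this universal property is $*$-isomorphic to the right-hand side. Here $F_q$ is the free group of rank $q$, and $C^*(G)$ is the full $C^*$-algebra of the discrete group $G$, i.e. the Hausdorff completion of $\mathbb C[G]$ in its largest $C^*$-seminorm. -/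

import Mathlib

open scoped ComplexOrder

noncomputable section

namespace AmalgFD

/-! ### The full C⋆-algebra of a discrete group -/

section GroupCStar

/-- The complex group algebra `ℂ[G]`; a type synonym which will carry its involution and the
largest C⋆-seminorm. -/
def GroupAlg (G : Type*) [Group G] : Type _ := MonoidAlgebra ℂ G

variable {G : Type*} [Group G]

instance : Ring (GroupAlg G) := inferInstanceAs (Ring (MonoidAlgebra ℂ G))

instance : Algebra ℂ (GroupAlg G) := inferInstanceAs (Algebra ℂ (MonoidAlgebra ℂ G))

/-- The element `c • g` of the group algebra. -/
def GroupAlg.single (g : G) (c : ℂ) : GroupAlg G := MonoidAlgebra.single g c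

/-- The conjugate-linear involution of `ℂ[G]` with `g⋆ = g⁻¹`. -/
instance : Star (GroupAlg G) where
  star f := MonoidAlgebra.mapDomain (fun g : G => g⁻¹)
    (MonoidAlgebra.map ((starRingEnd ℂ : ℂ →+* ℂ) : ℂ →+ ℂ) f)

theorem GroupAlg.star_single (g : G) (c : ℂ) :
    star (GroupAlg.single g c) = GroupAlg.single g⁻¹ (star c) := by
  change MonoidAlgebra.mapDomain _ (MonoidAlgebra.map _ (MonoidAlgebra.single g c)) = _
  rw [MonoidAlgebra.map_single, MonoidAlgebra.mapDomain_single]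
  rfl

theorem GroupAlg.single_mul_single (g h : G) (c d : ℂ) :
    GroupAlg.single g c * GroupAlg.single h d = GroupAlg.single (g * h) (c * d) :=
  MonoidAlgebra.single_mul_single ..

theorem GroupAlg.smul_single (z : ℂ) (g : G) (c : ℂ) :
    z • GroupAlg.single g c = GroupAlg.single g (z * c) :=
  MonoidAlgebra.smul_single ..

@[elab_as_elim]
theorem GroupAlg.induction {p : GroupAlg G → Prop} (f : GroupAlg G) (zero : p 0)
    (add : ∀ a b, p a → p b → p (a + b)) (single : ∀ g c, p (GroupAlg.single g c)) : p f :=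
  MonoidAlgebra.induction_linear f zero add single

theorem GroupAlg.star_add' (a b : GroupAlg G) : star (a + b) = star a + star b := by
  have h : ∀ x y : MonoidAlgebra ℂ G,
      MonoidAlgebra.mapDomain (fun g : G => g⁻¹)
        (MonoidAlgebra.map ((starRingEnd ℂ : ℂ →+* ℂ) : ℂ →+ ℂ) (x + y)) =
      MonoidAlgebra.mapDomain (fun g : G => g⁻¹)
        (MonoidAlgebra.map ((starRingEnd ℂ : ℂ →+* ℂ) : ℂ →+ ℂ) x) +
      MonoidAlgebra.mapDomain (fun g : G => g⁻¹)
        (MonoidAlgebra.map ((starRingEnd ℂ : ℂ →+* ℂ) : ℂ →+ ℂ) y) := fun x y => by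
    rw [MonoidAlgebra.map_add, MonoidAlgebra.mapDomain_add]
  exact h a b

theorem GroupAlg.star_zero' : star (0 : GroupAlg G) = 0 := by
  have h := GroupAlg.star_add' (0 : GroupAlg G) 0
  rw [add_zero] at h
  exact left_eq_add.mp h

instance : StarRing (GroupAlg G) where
  star_involutive a := by
    induction a using GroupAlg.induction with
    | zero => rw [GroupAlg.star_zero', GroupAlg.star_zero']
    | add a b ha hb => rw [GroupAlg.star_add', GroupAlg.star_add', ha, hb]
    | single g c => simp [GroupAlg.star_single]
  star_add := GroupAlg.star_add'
  star_mul a b := by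
    induction a using GroupAlg.induction with
    | zero => simp [GroupAlg.star_zero']
    | add a a' ha hb => simp only [add_mul, mul_add, GroupAlg.star_add', ha, hb]
    | single g c =>
      induction b using GroupAlg.induction with
      | zero => simp [GroupAlg.star_zero']
      | add b b' ha hb => simp only [add_mul, mul_add, GroupAlg.star_add', ha, hb]
      | single h d =>
        simp [GroupAlg.star_single, GroupAlg.single_mul_single, mul_comm]

instance : StarModule ℂ (GroupAlg G) where
  star_smul z a := by
    induction a using GroupAlg.induction with
    | zero => simp
    | add a b ha hb => simp only [smul_add, star_add, ha, hb]
    | single g c => simp [GroupAlg.star_single, GroupAlg.smul_single]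

/-- `p` is a C⋆-seminorm on the group algebra. -/
structure IsCStarSeminorm (p : Seminorm ℂ (GroupAlg G)) : Prop where
  mul_le : ∀ a b, p (a * b) ≤ p a * p b
  star_mul_self : ∀ a, p (star a * a) = p a * p a

theorem IsCStarSeminorm.star_eq {p : Seminorm ℂ (GroupAlg G)} (hp : IsCStarSeminorm p)
    (a : GroupAlg G) : p (star a) = p a := by
  have key : ∀ b : GroupAlg G, p b ≤ p (star b) := fun b => by
    have h1 := hp.mul_le (star b) b
    rw [hp.star_mul_self] at h1
    rcases (apply_nonneg p b).eq_or_lt with h | h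
    · rw [← h]; exact apply_nonneg p _
    · exact le_of_mul_le_mul_right h1 h
  refine le_antisymm ?_ (key a)
  simpa using key (star a)

theorem IsCStarSeminorm.one_le {p : Seminorm ℂ (GroupAlg G)} (hp : IsCStarSeminorm p) :
    p 1 ≤ 1 := by
  have h := hp.star_mul_self 1
  rw [star_one, mul_one] at h
  nlinarith [apply_nonneg p (1 : GroupAlg G)]

theorem IsCStarSeminorm.single_le {p : Seminorm ℂ (GroupAlg G)} (hp : IsCStarSeminorm p)
    (g : G) (c : ℂ) : p (GroupAlg.single g c) ≤ ‖c‖ := by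
  have h1 : p (GroupAlg.single g 1) ≤ 1 := by
    have h := hp.star_mul_self (GroupAlg.single g 1)
    have e : star (GroupAlg.single g (1 : ℂ)) * GroupAlg.single g 1 = 1 := by
      rw [GroupAlg.star_single, GroupAlg.single_mul_single]
      simp only [inv_mul_cancel, star_one, mul_one]
      rfl
    rw [e] at h
    nlinarith [hp.one_le, apply_nonneg p (GroupAlg.single g (1 : ℂ))]
  have h2 : GroupAlg.single g c = c • GroupAlg.single g 1 := by
    rw [GroupAlg.smul_single, mul_one]
  rw [h2, map_smul_eq_mul]
  exact mul_le_of_le_one_right (norm_nonneg c) h1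

/-- At each element of `ℂ[G]` the C⋆-seminorms are bounded. -/
theorem bddAbove_cstarSeminorm (a : GroupAlg G) :
    BddAbove (Set.range fun p : {p : Seminorm ℂ (GroupAlg G) // IsCStarSeminorm p} => p.1 a) := by
  induction a using GroupAlg.induction with
  | zero => exact ⟨0, by rintro _ ⟨p, rfl⟩; simp⟩
  | add a b ha hb =>
    obtain ⟨A, hA⟩ := ha
    obtain ⟨B, hB⟩ := hb
    refine ⟨A + B, ?_⟩
    rintro _ ⟨p, rfl⟩
    exact (map_add_le_add p.1 a b).trans (add_le_add (hA ⟨p, rfl⟩) (hB ⟨p, rfl⟩))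
  | single g c => exact ⟨‖c‖, by rintro _ ⟨p, rfl⟩; exact p.2.single_le g c⟩

/-- The largest C⋆-seminorm on the group algebra, the supremum of all C⋆-seminorms. -/
def maxNorm (a : GroupAlg G) : ℝ :=
  ⨆ p : {p : Seminorm ℂ (GroupAlg G) // IsCStarSeminorm p}, p.1 a

instance : Nonempty {p : Seminorm ℂ (GroupAlg G) // IsCStarSeminorm p} :=
  ⟨⟨0, ⟨fun _ _ => by simp, fun _ => by simp⟩⟩⟩

theorem le_maxNorm (p : Seminorm ℂ (GroupAlg G)) (hp : IsCStarSeminorm p) (a : GroupAlg G) :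
    p a ≤ maxNorm a :=
  le_ciSup (bddAbove_cstarSeminorm a) ⟨p, hp⟩

theorem maxNorm_nonneg (a : GroupAlg G) : 0 ≤ maxNorm a :=
  Real.iSup_nonneg fun p => apply_nonneg p.1 a

theorem maxNorm_mul_le (a b : GroupAlg G) : maxNorm (a * b) ≤ maxNorm a * maxNorm b :=
  ciSup_le fun p => (p.2.mul_le a b).trans <|
    mul_le_mul (le_maxNorm _ p.2 a) (le_maxNorm _ p.2 b) (apply_nonneg _ _) (maxNorm_nonneg a)

theorem maxNorm_star (a : GroupAlg G) : maxNorm (star a) = maxNorm a :=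
  iSup_congr fun p => p.2.star_eq a

theorem maxNorm_star_mul_self (a : GroupAlg G) :
    maxNorm (star a * a) = maxNorm a * maxNorm a := by
  refine le_antisymm ((maxNorm_mul_le _ _).trans_eq (by rw [maxNorm_star])) ?_
  have h : maxNorm a ≤ √(maxNorm (star a * a)) := ciSup_le fun p =>
    Real.le_sqrt_of_sq_le (by rw [sq, ← p.2.star_mul_self]; exact le_maxNorm _ p.2 _)
  exact (mul_self_le_mul_self (maxNorm_nonneg a) h).trans_eq
    (Real.mul_self_sqrt (maxNorm_nonneg _))

instance : SeminormedRing (GroupAlg G) :=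
  RingSeminorm.toSeminormedRing
    { toFun := maxNorm
      map_zero' := by simp [maxNorm]
      add_le' := fun a b => ciSup_le fun p => (map_add_le_add p.1 a b).trans <|
        add_le_add (le_maxNorm _ p.2 a) (le_maxNorm _ p.2 b)
      neg' := fun a => iSup_congr fun p => map_neg_eq_map p.1 a
      mul_le' := maxNorm_mul_le }

theorem GroupAlg.norm_def (a : GroupAlg G) : ‖a‖ = maxNorm a := rfl

instance : NormedAlgebra ℂ (GroupAlg G) where
  norm_smul_le z a := ciSup_le fun p => by
    rw [map_smul_eq_mul]
    exact mul_le_mul_of_nonneg_left (le_maxNorm _ p.2 a) (norm_nonneg z)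

instance : NormedStarGroup (GroupAlg G) where
  norm_star_le a := (maxNorm_star a).le

variable (G) in
/-- The full group C⋆-algebra `C⋆(G)` of a discrete group: the Hausdorff completion of `ℂ[G]` in
its largest C⋆-seminorm. -/
def FullGroupCStar : Type _ := UniformSpace.Completion (GroupAlg G)

namespace FullGroupCStar

instance : NormedRing (FullGroupCStar G) :=
  inferInstanceAs (NormedRing (UniformSpace.Completion (GroupAlg G)))

instance : NormedAlgebra ℂ (FullGroupCStar G) where
  __ := (inferInstanceAs (Algebra ℂ (UniformSpace.Completion (GroupAlg G))) :
    Algebra ℂ (UniformSpace.Completion (GroupAlg G)))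
  norm_smul_le z x := norm_smul_le (β := UniformSpace.Completion (GroupAlg G)) z x

instance : CompleteSpace (FullGroupCStar G) :=
  inferInstanceAs (CompleteSpace (UniformSpace.Completion (GroupAlg G)))

/-- The canonical map `ℂ[G] → C⋆(G)`. -/
def of (a : GroupAlg G) : FullGroupCStar G := (a : UniformSpace.Completion (GroupAlg G))

theorem of_add (a b : GroupAlg G) : of (a + b) = of a + of b := UniformSpace.Completion.coe_add a b

theorem of_mul (a b : GroupAlg G) : of (a * b) = of a * of b := UniformSpace.Completion.coe_mul a b

theorem of_smul (z : ℂ) (a : GroupAlg G) : of (z • a) = z • of a :=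
  UniformSpace.Completion.coe_smul z a

theorem norm_of (a : GroupAlg G) : ‖of a‖ = maxNorm a := UniformSpace.Completion.norm_coe a

theorem denseRange_of : DenseRange (of : GroupAlg G → FullGroupCStar G) :=
  UniformSpace.Completion.denseRange_coe

/-- The involution of `C⋆(G)` is the continuous extension of that of `ℂ[G]`. -/
instance : Star (FullGroupCStar G) where
  star := UniformSpace.Completion.map (star : GroupAlg G → GroupAlg G)

theorem star_of (a : GroupAlg G) : star (of a) = of (star a) :=
  UniformSpace.Completion.map_coe (star_isometry (E := GroupAlg G)).uniformContinuous a

theorem continuous_star' : Continuous (star : FullGroupCStar G → FullGroupCStar G) :=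
  UniformSpace.Completion.continuous_map

theorem induction_of {p : FullGroupCStar G → Prop} (hp : IsClosed {x | p x})
    (h : ∀ a, p (of a)) (x : FullGroupCStar G) : p x :=
  denseRange_of.induction_on x hp h

instance : StarRing (FullGroupCStar G) where
  star_involutive x := by
    induction x using induction_of with
    | hp => exact isClosed_eq (continuous_star'.comp continuous_star') continuous_id
    | h a => rw [star_of, star_of, star_star]
  star_add x y := by
    have hs := continuous_star' (G := G)
    induction x using induction_of with
    | hp => exact isClosed_eq (by fun_prop) (by fun_prop)
    | h a =>
      induction y using induction_of with
      | hp => exact isClosed_eq (by fun_prop) (by fun_prop)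
      | h b => rw [← of_add, star_of, star_add, of_add, star_of, star_of]
  star_mul x y := by
    have hs := continuous_star' (G := G)
    induction x using induction_of with
    | hp => exact isClosed_eq (by fun_prop) (by fun_prop)
    | h a =>
      induction y using induction_of with
      | hp => exact isClosed_eq (by fun_prop) (by fun_prop)
      | h b => rw [← of_mul, star_of, star_mul, of_mul, star_of, star_of]

instance : StarModule ℂ (FullGroupCStar G) where
  star_smul z x := by
    have hs := continuous_star' (G := G)
    have h1 : Continuous fun x : FullGroupCStar G => z • x := continuous_const_smul z
    have h2 : Continuous fun x : FullGroupCStar G => star z • x := continuous_const_smul (star z)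
    have hc : IsClosed {x : FullGroupCStar G | star (z • x) = star z • star x} :=
      isClosed_eq (hs.comp h1) (h2.comp hs)
    induction x using induction_of with
    | hp => exact hc
    | h a => rw [← of_smul, star_of, star_smul, of_smul, star_of]

instance : CStarRing (FullGroupCStar G) where
  norm_mul_self_le x := by
    have hs := continuous_star' (G := G)
    induction x using induction_of with
    | hp => exact isClosed_le (by fun_prop) (by fun_prop)
    | h a => rw [star_of, ← of_mul, norm_of, norm_of, maxNorm_star_mul_self]

instance : CStarAlgebra (FullGroupCStar G) where

/-- The usual order of a C⋆-algebra, which Mathlib's C⋆-norm on matrices asks for. -/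
instance : PartialOrder (FullGroupCStar G) := CStarAlgebra.spectralOrder _

instance : StarOrderedRing (FullGroupCStar G) := CStarAlgebra.spectralOrderedRing _

end FullGroupCStar

end GroupCStar

/-! ### Amalgamated free products of C⋆-algebras -/

/-- `T`, with the ⋆-homomorphisms `ψ₁ : A → T` and `ψ₂ : B → T`, is the free product of `A` and `B`
amalgamated over `D` (along `i₁ : D → A` and `i₂ : D → B`) in the category of C⋆-algebras and
⋆-homomorphisms, tested against all C⋆-algebras `R`, unital or not, in the universe `u`. -/
structure IsAmalgam.{u, v₀, v₁, v₂, v₃} {D : Type v₀} {A : Type v₁} {B : Type v₂} {T : Type v₃}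
    [NonUnitalCStarAlgebra D] [NonUnitalCStarAlgebra A] [NonUnitalCStarAlgebra B]
    [NonUnitalCStarAlgebra T] (i₁ : D →⋆ₙₐ[ℂ] A) (i₂ : D →⋆ₙₐ[ℂ] B)
    (ψ₁ : A →⋆ₙₐ[ℂ] T) (ψ₂ : B →⋆ₙₐ[ℂ] T) : Prop where
  comm : ψ₁.comp i₁ = ψ₂.comp i₂
  existsUnique_lift : ∀ (R : Type u) [NonUnitalCStarAlgebra R]
    (φ₁ : A →⋆ₙₐ[ℂ] R) (φ₂ : B →⋆ₙₐ[ℂ] R), φ₁.comp i₁ = φ₂.comp i₂ →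
      ∃! l : T →⋆ₙₐ[ℂ] R, l.comp ψ₁ = φ₁ ∧ l.comp ψ₂ = φ₂

/-! ### Direct sums of matrix algebras and their diagonals -/

/-- The C⋆-algebra `⊕ᵢ M_{m i}(ℂ)`. -/
abbrev MatSum {r : ℕ} (m : Fin r → ℕ) : Type := ∀ i : Fin r, CStarMatrix (Fin (m i)) (Fin (m i)) ℂ

/-- The diagonal matrix units of `⊕ᵢ M_{m i}`: the pair `⟨i, a⟩` stands for the matrix unit
`e_{a a}` of the `i`-th summand. -/
abbrev DiagUnit {r : ℕ} (m : Fin r → ℕ) : Type := (i : Fin r) × Fin (m i)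

/-- The inclusion of `ℂ^N` as the diagonal matrices of `⊕ᵢ M_{m i}`, for an enumeration `α` of the
diagonal matrix units: the `e`-th standard basis vector goes to the matrix unit `α e`. -/
def diagEmb {r N : ℕ} {m : Fin r → ℕ} (α : Fin N ≃ DiagUnit m) : (Fin N → ℂ) →⋆ₙₐ[ℂ] MatSum m where
  toFun f i := CStarMatrix.ofMatrix (Matrix.diagonal fun a => f (α.symm ⟨i, a⟩))
  map_smul' z f := by
    ext i a b
    simp [Matrix.diagonal_apply]
  map_zero' := by
    ext i a b
    simp
  map_add' f g := by
    ext i a b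
    by_cases h : a = b <;> simp [h]
  map_mul' f g := by
    funext i
    exact congrArg CStarMatrix.ofMatrix (Matrix.diagonal_mul_diagonal _ _).symm
  map_star' f := by
    funext i
    exact congrArg CStarMatrix.ofMatrix (Matrix.diagonal_conjTranspose _).symm

/-! ### The graph of the amalgam

It is a bipartite multigraph: its vertices are the summands of `P` and of `Q`, its edges are
`0, …, N - 1`, and the edge `e` joins the summand of `P` containing the matrix unit `α e` to the
summand of `Q` containing the matrix unit `β e`. -/

section Graph

variable {r s N : ℕ} {m : Fin r → ℕ} {n : Fin s → ℕ}
  (α : Fin N ≃ DiagUnit m) (β : Fin N ≃ DiagUnit n)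

/-- The adjacency in the multigraph when only the edges in `F` are kept (parallel edges are
collapsed here; this is used only to speak of paths and components). -/
def adjGraph (F : Set (Fin N)) : SimpleGraph (Fin r ⊕ Fin s) :=
  SimpleGraph.fromRel fun x y => ∃ e ∈ F, x = Sum.inl (α e).1 ∧ y = Sum.inr (β e).1

/-- The connected components of the graph. -/
def Component : Type := (adjGraph α β Set.univ).ConnectedComponent

instance : Fintype (Component α β) :=
  @Fintype.ofFinite _ (inferInstanceAs (Finite (adjGraph α β Set.univ).ConnectedComponent))

/-- The component of a vertex. -/
def componentOf (x : Fin r ⊕ Fin s) : Component α β :=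
  (adjGraph α β Set.univ).connectedComponentMk x

variable {α β}

/-- The edges of a component, parallel edges being counted separately. -/
def Component.edges (W : Component α β) : Set (Fin N) :=
  {e | componentOf α β (Sum.inl (α e).1) = W}

/-- The edge set `F` is (the edge set of) a spanning tree of the component `W`: it consists of
edges of `W`, it joins any two vertices of `W`, and no edge of `F` can be left out. -/
structure Component.IsSpanningTree (W : Component α β) (F : Set (Fin N)) : Prop where
  subset : F ⊆ W.edges
  connects : ∀ x y, componentOf α β x = W → componentOf α β y = W → (adjGraph α β F).Reachable x y
  minimal : ∀ e ∈ F, ¬ (adjGraph α β (F \ {e})).Reachable (Sum.inl (α e).1) (Sum.inr (β e).1)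

/-- The C⋆-algebra `⊕_W M_{k_W}(C⋆(F_{q_W}))`, summed over the components `W` of the graph, with
`k_W` the number of edges of `W` and `q_W` the number of edges of `W` outside `F W`. -/
abbrev FreeGroupMatSum (F : Component α β → Set (Fin N)) : Type :=
  ∀ W : Component α β, CStarMatrix (Fin W.edges.ncard) (Fin W.edges.ncard)
    (FullGroupCStar (FreeGroup (Fin (W.edges \ F W).ncard)))

end Graph

end AmalgFD

end

open AmalgFD

universe u

/-!
The free product `P *_{ℂ^N} Q` is generated by two systems of matrix units: `P e f`, for edges `e`,
`f` that meet in a summand of `P`, and `Q e f`, for edges that meet in a summand of `Q`, with the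
same diagonal units `P e e = Q e e`. Thus it is the C⋆-algebra of the groupoid with the edges as
objects that these units generate freely: the fundamental groupoid of the graph, based at the
midpoints of the edges. A connected groupoid is equivalent to its vertex group, here the free group
on the edges outside a spanning tree, and this gives one summand `M_k(C⋆(F_q))` for each component.

The isomorphism is made explicit by a gauge. In the target, `P e f` is the matrix unit `E e f`
(`leftEmb`) and `Q e f` is `c e * (c f)⁻¹` times `E e f` (`rightEmb`), where the label `c e` is
trivial on the spanning tree and a free generator off it (`edgeLabel`).

* Uniqueness of the factorization (`hom_eq_of_comp_eq`): since the tree is connected, products of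
  the given units are all `E e f`; then the units `Q e f` with `f` in the tree give the generators.
* Existence (`exists_hom_comp_eq`): for a pair of ⋆-homomorphisms into a C⋆-algebra `R`, one needs
  partial isometries `L e` in `R`, with common source in each component, such that
  `P e f = L e * star (L f)`, and `Q e f = L e * star (L f)` for `e`, `f` in the tree. They are
  built by adding the edges of the forest one by one (`exists_isTrivialization`): as a tree has no cycles,
  the `L` on one side of a new edge can be corrected by a unitary of a corner. For an edge `e`
  outside the tree, the defect of the second equation is a unitary of the corner, to which the
  generator `c e` is sent; the resulting representation of the free group extends to its full
  C⋆-algebra (`FullGroupCStar.exists_hom_of_cornerUnitary`), because a ⋆-homomorphism on `ℂ[G]`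
  pulls the norm back to a C⋆-seminorm.
-/

namespace AmalgFD

/-! ### The universal property of the full group C⋆-algebra -/

section Corner

variable {R : Type*} [NonUnitalCStarAlgebra R]

/-- The unitary group of the corner `r R r` cut out by a projection `r`. -/
structure CornerUnitary (r : R) (hr : IsStarProjection r) where
  val : R
  proj_mul : r * val = val
  mul_proj : val * r = val
  star_mul_val : star val * val = r
  val_mul_star : val * star val = r

namespace CornerUnitary

variable {r : R} {hr : IsStarProjection r}

@[ext]
theorem ext {x y : CornerUnitary r hr} (h : x.val = y.val) : x = y := by
  cases x; cases y; cases h; rfl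

instance : Group (CornerUnitary r hr) where
  mul x y :=
    { val := x.val * y.val
      proj_mul := by rw [← mul_assoc, x.proj_mul]
      mul_proj := by rw [mul_assoc, y.mul_proj]
      star_mul_val := by
        rw [star_mul, mul_assoc, ← mul_assoc (star x.val), x.star_mul_val, y.proj_mul,
          y.star_mul_val]
      val_mul_star := by
        rw [star_mul, mul_assoc, ← mul_assoc y.val, y.val_mul_star, ← mul_assoc, x.mul_proj,
          x.val_mul_star] }
  one :=
    { val := r
      proj_mul := hr.isIdempotentElem
      mul_proj := hr.isIdempotentElem
      star_mul_val := by rw [hr.isSelfAdjoint.star_eq]; exact hr.isIdempotentElem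
      val_mul_star := by rw [hr.isSelfAdjoint.star_eq]; exact hr.isIdempotentElem }
  inv x :=
    { val := star x.val
      proj_mul := by
        simpa only [star_mul, hr.isSelfAdjoint.star_eq] using congrArg star x.mul_proj
      mul_proj := by
        simpa only [star_mul, hr.isSelfAdjoint.star_eq] using congrArg star x.proj_mul
      star_mul_val := by rw [star_star, x.val_mul_star]
      val_mul_star := by rw [star_star, x.star_mul_val] }
  mul_assoc x y z := ext (mul_assoc x.val y.val z.val)
  one_mul x := ext x.proj_mul
  mul_one x := ext x.mul_proj
  inv_mul_cancel x := ext x.star_mul_val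

theorem val_inv (x : CornerUnitary r hr) : x⁻¹.val = star x.val := rfl

end CornerUnitary

end Corner

namespace FullGroupCStar

variable {G : Type*} [Group G] {R : Type*} [NonUnitalCStarAlgebra R]

/-- A ⋆-homomorphism on `ℂ[G]` is contractive for the largest C⋆-seminorm, because it pulls the
norm back to a C⋆-seminorm. -/
theorem norm_apply_le_maxNorm (φ : GroupAlg G →⋆ₙₐ[ℂ] R) (a : GroupAlg G) :
    ‖φ a‖ ≤ maxNorm a :=
  le_maxNorm ((normSeminorm ℂ R).comp (φ : GroupAlg G →ₗ[ℂ] R))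
    { mul_le := fun a b => by
        simpa using norm_mul_le (φ a) (φ b)
      star_mul_self := fun a => by
        simpa [map_star] using CStarRing.norm_star_mul_self (x := φ a) } a

/-- Every ⋆-homomorphism from `ℂ[G]` to a C⋆-algebra extends to `C⋆(G)`. -/
theorem exists_extension (φ : GroupAlg G →⋆ₙₐ[ℂ] R) :
    ∃ π : FullGroupCStar G →⋆ₙₐ[ℂ] R, ∀ a, π (of a) = φ a := by
  have hφ : UniformContinuous φ :=
    AddMonoidHomClass.uniformContinuous_of_bound φ 1 fun a => by
      rw [one_mul]; exact norm_apply_le_maxNorm φ a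
  let f : FullGroupCStar G → R := UniformSpace.Completion.extension φ
  have hf : Continuous f := UniformSpace.Completion.continuous_extension
  have hof : ∀ a, f (of a) = φ a := UniformSpace.Completion.extension_coe hφ
  have hs := continuous_star' (G := G)
  have hsmul : ∀ z : ℂ, Continuous fun x : FullGroupCStar G => z • x := continuous_const_smul
  refine ⟨{ toFun := f, map_smul' := ?_, map_zero' := ?_, map_add' := ?_, map_mul' := ?_,
            map_star' := ?_ }, hof⟩
  · intro z x
    have hc : IsClosed {x | f (z • x) = z • f x} :=
      isClosed_eq (hf.comp (hsmul z)) (hf.const_smul z)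
    induction x using induction_of with
    | hp => exact hc
    | h a => rw [← of_smul, hof, hof, map_smul]; rfl
  · exact (hof 0).trans (map_zero φ)
  · intro x y
    induction x using induction_of with
    | hp => exact isClosed_eq (by fun_prop) (by fun_prop)
    | h a =>
      induction y using induction_of with
      | hp => exact isClosed_eq (by fun_prop) (by fun_prop)
      | h b => rw [← of_add, hof, hof, hof, map_add]
  · intro x y
    induction x using induction_of with
    | hp => exact isClosed_eq (by fun_prop) (by fun_prop)
    | h a =>
      induction y using induction_of with
      | hp => exact isClosed_eq (by fun_prop) (by fun_prop)
      | h b => rw [← of_mul, hof, hof, hof, map_mul]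
  · intro x
    induction x using induction_of with
    | hp => exact isClosed_eq (by fun_prop) (by fun_prop)
    | h a => rw [star_of, hof, hof, map_star]

/-- The element of `C⋆(G)` given by `g : G`. -/
noncomputable def elem (g : G) : FullGroupCStar G := of (GroupAlg.single g 1)

theorem elem_one : elem (1 : G) = 1 := rfl

theorem elem_mul (g h : G) : elem (g * h) = elem g * elem h := by
  rw [elem, elem, elem, ← of_mul, GroupAlg.single_mul_single, one_mul]

theorem star_elem (g : G) : star (elem g) = elem g⁻¹ := by
  rw [elem, elem, star_of, GroupAlg.star_single, star_one]

/-- A representation of `G` by unitaries of a corner of `R` extends to `C⋆(G)`. -/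
theorem exists_hom_of_cornerUnitary {r : R} {hr : IsStarProjection r}
    (u : G →* CornerUnitary r hr) :
    ∃ π : FullGroupCStar G →⋆ₙₐ[ℂ] R, ∀ g, π (elem g) = (u g).val := by
  let u' : G →ₙ* R := ⟨fun g => (u g).val, fun g h => by rw [map_mul]; rfl⟩
  let φ₀ : GroupAlg G →ₙₐ[ℂ] R := MonoidAlgebra.liftMagma ℂ u'
  have h₀ : ∀ g c, φ₀ (GroupAlg.single g c) = c • (u g).val := fun g c => by
    change MonoidAlgebra.liftMagma ℂ u' (MonoidAlgebra.single g c) = _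
    simp [MonoidAlgebra.liftMagma, u']
  let φ : GroupAlg G →⋆ₙₐ[ℂ] R :=
    { φ₀ with
      map_star' := fun a => by
        change φ₀ (star a) = star (φ₀ a)
        induction a using GroupAlg.induction with
        | zero => simp
        | add a b ha hb => rw [star_add, map_add, map_add, star_add, ha, hb]
        | single g c =>
          rw [GroupAlg.star_single, h₀, h₀, map_inv, CornerUnitary.val_inv, star_smul] }
  obtain ⟨π, hπ⟩ := exists_extension φ
  exact ⟨π, fun g => (hπ _).trans ((h₀ g 1).trans (one_smul _ _))⟩

/-- Two ⋆-homomorphisms on `C⋆(G)` that agree on `G` are equal. -/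
theorem hom_ext {π π' : FullGroupCStar G →⋆ₙₐ[ℂ] R} (h : ∀ g, π (elem g) = π' (elem g)) :
    π = π' := by
  have hc : ∀ ρ : FullGroupCStar G →⋆ₙₐ[ℂ] R, Continuous ρ := fun ρ =>
    AddMonoidHomClass.continuous_of_bound ρ 1 fun a => by
      rw [one_mul]; exact NonUnitalStarAlgHom.norm_apply_le ρ a
  ext x
  induction x using induction_of with
  | hp => exact isClosed_eq (hc π) (hc π')
  | h a =>
    induction a using GroupAlg.induction with
    | zero =>
      rw [show of (0 : GroupAlg G) = 0 from rfl, map_zero, map_zero]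
    | add a b ha hb => rw [of_add, map_add, map_add, ha, hb]
    | single g c =>
      have e : of (GroupAlg.single g c) = c • elem g := by
        rw [elem, ← of_smul, GroupAlg.smul_single, mul_one]
      rw [e, map_smul, map_smul, h]

end FullGroupCStar

/-! ### Paths, components and spanning trees -/

section Graph

variable {r s N : ℕ} {m : Fin r → ℕ} {n : Fin s → ℕ}
  {α : Fin N ≃ DiagUnit m} {β : Fin N ≃ DiagUnit n}

theorem adjGraph_adj {F : Set (Fin N)} {e : Fin N} (he : e ∈ F) :
    (adjGraph α β F).Adj (Sum.inl (α e).1) (Sum.inr (β e).1) :=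
  (SimpleGraph.fromRel_adj _ _ _).2 ⟨Sum.inl_ne_inr, Or.inl ⟨e, he, rfl, rfl⟩⟩

theorem adjGraph_mono {F F' : Set (Fin N)} (h : F ⊆ F') : adjGraph α β F ≤ adjGraph α β F' := by
  intro x y hxy
  obtain ⟨hne, hxy⟩ := (SimpleGraph.fromRel_adj _ _ _).1 hxy
  exact (SimpleGraph.fromRel_adj _ _ _).2
    ⟨hne, hxy.imp (fun ⟨e, he, h'⟩ => ⟨e, h he, h'⟩) fun ⟨e, he, h'⟩ => ⟨e, h he, h'⟩⟩

/-- A property of vertices that is transported both ways along the edges in `F` is transported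
along paths. -/
theorem reachable_induction {F : Set (Fin N)} {p : Fin r ⊕ Fin s → Prop} {x y : Fin r ⊕ Fin s}
    (h : (adjGraph α β F).Reachable x y) (hx : p x)
    (hlr : ∀ e ∈ F, p (Sum.inl (α e).1) → p (Sum.inr (β e).1))
    (hrl : ∀ e ∈ F, p (Sum.inr (β e).1) → p (Sum.inl (α e).1)) : p y := by
  rw [SimpleGraph.reachable_iff_reflTransGen] at h
  induction h with
  | refl => exact hx
  | tail _ hyz ih =>
    obtain ⟨-, ⟨e, he, rfl, rfl⟩ | ⟨e, he, rfl, rfl⟩⟩ := (SimpleGraph.fromRel_adj _ _ _).1 hyz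
    exacts [hlr e he ih, hrl e he ih]

theorem componentOf_eq_iff {x y : Fin r ⊕ Fin s} :
    componentOf α β x = componentOf α β y ↔ (adjGraph α β Set.univ).Reachable x y :=
  SimpleGraph.ConnectedComponent.eq

theorem componentOf_inl_eq_inr (e : Fin N) :
    componentOf α β (Sum.inl (α e).1) = componentOf α β (Sum.inr (β e).1) :=
  componentOf_eq_iff.2 (adjGraph_adj (Set.mem_univ e)).reachable

/-- A path uses only edges of the component it runs in. -/
theorem reachable_inter_edges {E : Set (Fin N)} {x y : Fin r ⊕ Fin s}
    (h : (adjGraph α β E).Reachable x y) :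
    (adjGraph α β (E ∩ (componentOf α β x).edges)).Reachable x y := by
  set E' := E ∩ (componentOf α β x).edges with hE'
  let p : Fin r ⊕ Fin s → Prop := fun z => componentOf α β z = componentOf α β x ∧
    (adjGraph α β E').Reachable x z
  refine (reachable_induction (p := p) h ⟨rfl, .rfl⟩ ?_ ?_).2
  · rintro e he ⟨h1, h2⟩
    exact ⟨(componentOf_inl_eq_inr e).symm.trans h1,
      h2.trans (adjGraph_adj (F := E') ⟨he, h1⟩).reachable⟩
  · rintro e he ⟨h1, h2⟩
    have h3 := (componentOf_inl_eq_inr e).trans h1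
    exact ⟨h3, h2.trans (adjGraph_adj (F := E') ⟨he, h3⟩).reachable.symm⟩

/-- A spanning tree is obtained as a minimal connecting set of edges. -/
theorem Component.exists_isSpanningTree (W : Component α β) :
    ∃ F : Set (Fin N), W.IsSpanningTree F := by
  let S : Set (Set (Fin N)) := {F | F ⊆ W.edges ∧ ∀ x y, componentOf α β x = W →
    componentOf α β y = W → (adjGraph α β F).Reachable x y}
  have hS : W.edges ∈ S := by
    refine ⟨subset_rfl, fun x y hx hy => ?_⟩
    subst hx
    have := reachable_inter_edges (componentOf_eq_iff.1 hy.symm)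
    rwa [Set.univ_inter] at this
  obtain ⟨F, hF⟩ := (Set.toFinite S).exists_minimal ⟨_, hS⟩
  refine ⟨F, hF.prop.1, hF.prop.2, fun e he hcon => ?_⟩
  -- if the ends of `e` are still joined without `e`, then `F \ {e}` is connecting too
  have key : F \ {e} ∈ S := by
    refine ⟨Set.sdiff_subset.trans hF.prop.1, fun x y hx hy => ?_⟩
    refine reachable_induction (hF.prop.2 x y hx hy) .rfl (fun f hf h => ?_) fun f hf h => ?_
    · by_cases hfe : f = e
      · subst hfe; exact h.trans hcon
      · exact h.trans (adjGraph_adj (F := F \ {e}) ⟨hf, hfe⟩).reachable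
    · by_cases hfe : f = e
      · subst hfe; exact h.trans hcon.symm
      · exact h.trans (adjGraph_adj (F := F \ {e}) ⟨hf, hfe⟩).reachable.symm
  exact (hF.le_of_le key Set.sdiff_subset he).2 rfl

/-- `T` is a spanning forest of the whole graph: it joins any two vertices of the same component,
and its edges are bridges. -/
structure IsSpanningForest (α : Fin N ≃ DiagUnit m) (β : Fin N ≃ DiagUnit n)
    (T : Set (Fin N)) : Prop where
  connects : ∀ x y, componentOf α β x = componentOf α β y → (adjGraph α β T).Reachable x y
  bridge : ∀ e ∈ T, ¬ (adjGraph α β (T \ {e})).Reachable (Sum.inl (α e).1) (Sum.inr (β e).1)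

theorem mem_iUnion_isSpanningTree {F : Component α β → Set (Fin N)}
    (hF : ∀ W : Component α β, W.IsSpanningTree (F W)) {e : Fin N} {W : Component α β}
    (he : e ∈ W.edges) :
    e ∈ ⋃ W, F W ↔ e ∈ F W := by
  refine ⟨fun h => ?_, fun h => Set.mem_iUnion.2 ⟨W, h⟩⟩
  obtain ⟨W', h⟩ := Set.mem_iUnion.1 h
  obtain rfl : W' = W := ((hF W').subset h).symm.trans he
  exact h

theorem isSpanningForest_iUnion {F : Component α β → Set (Fin N)}
    (hF : ∀ W : Component α β, W.IsSpanningTree (F W)) : IsSpanningForest α β (⋃ W, F W) where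
  connects x y h :=
    ((hF _).connects x y rfl h.symm).mono (adjGraph_mono (Set.subset_iUnion F _))
  bridge e he hcon := by
    obtain ⟨W, heW⟩ := Set.mem_iUnion.1 he
    obtain rfl := (hF W).subset heW
    refine (hF _).minimal e heW ((reachable_inter_edges hcon).mono (adjGraph_mono ?_))
    rintro f ⟨⟨hf, hfe⟩, hfW⟩
    exact ⟨(mem_iUnion_isSpanningTree hF hfW).1 hf, hfe⟩

/-- A summand of the second algebra that meets an edge meets an edge of the spanning forest. -/
theorem IsSpanningForest.exists_mem {T : Set (Fin N)} (hT : IsSpanningForest α β T) (e : Fin N) :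
    ∃ f ∈ T, (β f).1 = (β e).1 := by
  by_contra! h
  have := reachable_induction (p := fun y => y = Sum.inr (β e).1)
    (hT.connects _ _ (componentOf_inl_eq_inr e).symm) rfl
    (fun f _ hf => (Sum.inl_ne_inr hf).elim) fun f hf hf' => (h f hf (Sum.inr.inj hf')).elim
  exact Sum.inl_ne_inr this

end Graph

/-! ### Matrix units of a direct sum of matrix algebras -/

section MatrixUnits

variable {r N : ℕ} {m : Fin r → ℕ}

/-- The entry of `x` in row `γ e` and column `γ f`, where `x` is regarded as a block diagonal
matrix. -/
def entry (γ : Fin N ≃ DiagUnit m) (x : MatSum m) (e f : Fin N) : ℂ :=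
  Matrix.blockDiagonal' (fun i => CStarMatrix.ofMatrix.symm (x i)) (γ e) (γ f)

/-- The matrix unit of `⊕ᵢ M_{m i}` in row `γ e` and column `γ f`; it is `0` if these belong to
different summands. -/
def matUnit (γ : Fin N ≃ DiagUnit m) (e f : Fin N) : MatSum m := fun i =>
  CStarMatrix.ofMatrix (Matrix.blockDiag' (Matrix.single (γ e) (γ f) 1) i)

variable (γ : Fin N ≃ DiagUnit m)

theorem entry_of_ne (x : MatSum m) {e f : Fin N} (h : (γ e).1 ≠ (γ f).1) : entry γ x e f = 0 :=
  Matrix.blockDiagonal'_apply_ne _ _ _ h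

theorem entry_symm_symm (x : MatSum m) (i : Fin r) (a b : Fin (m i)) :
    entry γ x (γ.symm ⟨i, a⟩) (γ.symm ⟨i, b⟩) = x i a b := by
  simp [entry]

theorem entry_ext {x y : MatSum m} (h : ∀ e f, entry γ x e f = entry γ y e f) : x = y := by
  funext i
  ext a b
  rw [← entry_symm_symm γ x, h, entry_symm_symm]

theorem entry_zero (e f : Fin N) : entry γ 0 e f = 0 := by
  simp [entry, Matrix.blockDiagonal'_apply]

theorem entry_add (x y : MatSum m) (e f : Fin N) :
    entry γ (x + y) e f = entry γ x e f + entry γ y e f := by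
  simp only [entry, Matrix.blockDiagonal'_apply]
  split_ifs <;> simp

theorem entry_smul (z : ℂ) (x : MatSum m) (e f : Fin N) :
    entry γ (z • x) e f = z * entry γ x e f := by
  simp only [entry, Matrix.blockDiagonal'_apply]
  split_ifs <;> simp

theorem entry_mul (x y : MatSum m) (e g : Fin N) :
    entry γ (x * y) e g = ∑ f, entry γ x e f * entry γ y f g := by
  have h : entry γ (x * y) e g = (Matrix.blockDiagonal' (fun i => CStarMatrix.ofMatrix.symm (x i)) *
      Matrix.blockDiagonal' (fun i => CStarMatrix.ofMatrix.symm (y i))) (γ e) (γ g) := by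
    rw [← Matrix.blockDiagonal'_mul]
    rfl
  rw [h, Matrix.mul_apply, ← γ.sum_comp]
  rfl

theorem entry_star (x : MatSum m) (e f : Fin N) :
    entry γ (star x) e f = star (entry γ x f e) := by
  have h : entry γ (star x) e f =
      (Matrix.blockDiagonal' (fun i => CStarMatrix.ofMatrix.symm (x i))).conjTranspose
        (γ e) (γ f) := by
    rw [Matrix.blockDiagonal'_conjTranspose]
    rfl
  rw [h]
  rfl

theorem entry_sum {κ : Type*} (t : Finset κ) (x : κ → MatSum m) (e f : Fin N) :
    entry γ (∑ j ∈ t, x j) e f = ∑ j ∈ t, entry γ (x j) e f :=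
  map_sum (⟨⟨fun x => entry γ x e f, entry_zero γ e f⟩, fun x y => entry_add γ x y e f⟩ :
    MatSum m →+ ℂ) x t

theorem entry_diagEmb (z : Fin N → ℂ) (e f : Fin N) :
    entry γ (diagEmb γ z) e f = if e = f then z e else 0 := by
  have h : entry γ (diagEmb γ z) e f = (Matrix.blockDiagonal' fun i : Fin r =>
      Matrix.diagonal fun a => z (γ.symm ⟨i, a⟩)) (γ e) (γ f) := rfl
  rw [h, Matrix.blockDiagonal'_diagonal, Matrix.diagonal_apply]
  simp

theorem entry_matUnit (e f e' f' : Fin N) : entry γ (matUnit γ e f) e' f' =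
    if (γ e).1 = (γ f).1 ∧ e = e' ∧ f = f' then 1 else 0 := by
  by_cases h : (γ e').1 = (γ f').1
  · obtain ⟨⟨i, a⟩, rfl⟩ := γ.symm.surjective e'
    obtain ⟨⟨j, b⟩, rfl⟩ := γ.symm.surjective f'
    obtain rfl : i = j := by simpa using h
    have h1 : entry γ (matUnit γ e f) (γ.symm ⟨i, a⟩) (γ.symm ⟨i, b⟩) =
        Matrix.single (γ e) (γ f) (1 : ℂ) ⟨i, a⟩ ⟨i, b⟩ := entry_symm_symm ..
    rw [h1, Matrix.single_apply]
    refine if_congr ?_ rfl rfl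
    simp only [Equiv.eq_symm_apply]
    refine ⟨fun h => ⟨by rw [h.1, h.2], h⟩, fun h => h.2⟩
  · rw [entry_of_ne γ _ h, if_neg]
    rintro ⟨h1, rfl, rfl⟩
    exact h h1

variable {γ}

theorem matUnit_mul {e f g : Fin N} (hef : (γ e).1 = (γ f).1) (hfg : (γ f).1 = (γ g).1) :
    matUnit γ e f * matUnit γ f g = matUnit γ e g := by
  refine entry_ext γ fun e' g' => ?_
  simp only [entry_mul, entry_matUnit, hef, hfg, true_and]
  by_cases h1 : e = e' <;> by_cases h2 : g = g' <;> simp [h1, h2]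

theorem matUnit_mul_of_ne {f f' : Fin N} (h : f ≠ f') (e g : Fin N) :
    matUnit γ e f * matUnit γ f' g = 0 := by
  refine entry_ext γ fun e' g' => ?_
  rw [entry_mul, entry_zero]
  refine Finset.sum_eq_zero fun d _ => ?_
  rw [entry_matUnit, entry_matUnit]
  by_cases hd : f = d
  · rw [if_neg (c := _ ∧ f' = d ∧ _) (fun h' => h (hd.trans h'.2.1.symm)), mul_zero]
  · rw [if_neg (fun h' => hd h'.2.2), zero_mul]

theorem star_matUnit (e f : Fin N) : star (matUnit γ e f) = matUnit γ f e := by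
  refine entry_ext γ fun e' f' => ?_
  rw [entry_star, entry_matUnit, entry_matUnit, apply_ite star, star_one, star_zero]
  exact if_congr ⟨fun h => ⟨h.1.symm, h.2.2, h.2.1⟩, fun h => ⟨h.1.symm, h.2.2, h.2.1⟩⟩ rfl rfl

theorem diagEmb_single (e : Fin N) : diagEmb γ (Pi.single e 1) = matUnit γ e e := by
  refine entry_ext γ fun e' f' => ?_
  rw [entry_diagEmb, entry_matUnit, Pi.single_apply]
  grind

theorem eq_sum_matUnit (x : MatSum m) : x = ∑ e, ∑ f, entry γ x e f • matUnit γ e f := by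
  refine entry_ext γ fun e' f' => ?_
  simp only [entry_sum, entry_smul, entry_matUnit]
  by_cases h : (γ e').1 = (γ f').1
  · rw [Finset.sum_eq_single e', Finset.sum_eq_single f']
    · simp [h]
    · intro f _ hf; simp [hf]
    · simp
    · intro e _ he; simp [he]
    · simp
  · rw [entry_of_ne γ x h]
    symm
    refine Finset.sum_eq_zero fun e _ => Finset.sum_eq_zero fun f _ => ?_
    rw [if_neg, mul_zero]
    rintro ⟨h1, rfl, rfl⟩
    exact h h1

/-- ⋆-homomorphisms on `⊕ᵢ M_{m i}` are determined by the matrix units. -/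
theorem matSum_hom_ext {R : Type*} [NonUnitalCStarAlgebra R] {φ φ' : MatSum m →⋆ₙₐ[ℂ] R}
    (h : ∀ e f, (γ e).1 = (γ f).1 → φ (matUnit γ e f) = φ' (matUnit γ e f)) : φ = φ' := by
  ext x
  rw [eq_sum_matUnit (γ := γ) x]
  simp only [map_sum, map_smul]
  refine Finset.sum_congr rfl fun e _ => Finset.sum_congr rfl fun f _ => ?_
  by_cases hef : (γ e).1 = (γ f).1
  · rw [h e f hef]
  · rw [entry_of_ne γ x hef, zero_smul, zero_smul]

end MatrixUnits

/-! ### Direct sums of matrix algebras over group C⋆-algebras -/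

section MatGroupSum

variable {ω : Type} {k : ω → ℕ} {G : ω → Type} [∀ W, Group (G W)]

/-- The C⋆-algebra `⊕_W M_{k W}(C⋆(G W))`. -/
abbrev MatGroupSum (k : ω → ℕ) (G : ω → Type) [∀ W, Group (G W)] : Type :=
  ∀ W : ω, CStarMatrix (Fin (k W)) (Fin (k W)) (FullGroupCStar (G W))

/-- The element of `⊕_W M_{k W}(C⋆(G W))` with the only entry `x`, in row `a` and column `b` of the
summand `W`. -/
noncomputable def entryUnit [DecidableEq ω] (W : ω) (a b : Fin (k W)) (x : FullGroupCStar (G W)) :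
    MatGroupSum k G :=
  Pi.single W (CStarMatrix.ofMatrix (Matrix.single a b x))

theorem entryUnit_mul [DecidableEq ω] {W : ω} (a b c : Fin (k W)) (x y : FullGroupCStar (G W)) :
    entryUnit W a b x * entryUnit W b c y = entryUnit W a c (x * y) := by
  rw [entryUnit, entryUnit, ← Pi.single_mul]
  exact congrArg _ (Matrix.single_mul_single_same (c := x) a b c y)

theorem star_entryUnit [DecidableEq ω] {W : ω} (a b : Fin (k W)) (x : FullGroupCStar (G W)) :
    star (entryUnit W a b x) = entryUnit W b a (star x) := by
  rw [entryUnit, entryUnit, ← Pi.single_star]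
  exact congrArg _ (Matrix.conjTranspose_single a b x)

/-- The embedding of `C⋆(G W)` as a diagonal entry. -/
noncomputable def cornerHom [DecidableEq ω] (W : ω) (a : Fin (k W)) :
    FullGroupCStar (G W) →⋆ₙₐ[ℂ] MatGroupSum k G where
  toFun := entryUnit W a a
  map_smul' z x := by
    rw [entryUnit, entryUnit, MonoidHom.id_apply, ← Pi.single_smul]
    exact congrArg _ (Matrix.smul_single z a a x).symm
  map_zero' := by
    rw [entryUnit, Matrix.single_zero]
    exact Pi.single_zero W
  map_add' x y := by
    rw [entryUnit, entryUnit, entryUnit, ← Pi.single_add]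
    exact congrArg _ (Matrix.single_add a a x y)
  map_mul' x y := (entryUnit_mul a a a x y).symm
  map_star' x := (star_entryUnit a a x).symm

theorem eq_sum_entryUnit [Fintype ω] [DecidableEq ω] (x : MatGroupSum k G) :
    x = ∑ W, ∑ a, ∑ b, entryUnit W a b (x W a b) := by
  have h (W : ω) : ∑ a, ∑ b, entryUnit W a b (x W a b) = (Pi.single W (x W) : MatGroupSum k G) := by
    have h1 : x W = ∑ a, ∑ b, CStarMatrix.ofMatrix (Matrix.single a b (x W a b)) :=
      Matrix.matrix_eq_sum_single (CStarMatrix.ofMatrix.symm (x W))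
    conv_rhs => rw [h1]
    rw [← AddMonoidHom.single_apply, map_sum]
    refine Finset.sum_congr rfl fun a _ => ?_
    rw [map_sum]
    rfl
  simp only [h]
  exact (Finset.univ_sum_single x).symm

/-- ⋆-homomorphisms on `⊕_W M_{k W}(C⋆(G W))` that agree on the matrices with a single entry, a
group element, are equal. -/
theorem matGroupSum_hom_ext [Fintype ω] [DecidableEq ω] {R : Type*} [NonUnitalCStarAlgebra R]
    {l l' : MatGroupSum k G →⋆ₙₐ[ℂ] R}
    (h : ∀ W a b g, l (entryUnit W a b (FullGroupCStar.elem g)) =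
      l' (entryUnit W a b (FullGroupCStar.elem g))) : l = l' := by
  have hd (W : ω) (a : Fin (k W)) : l.comp (cornerHom W a) = l'.comp (cornerHom W a) :=
    FullGroupCStar.hom_ext fun g => h W a a g
  ext x
  rw [eq_sum_entryUnit x]
  simp only [map_sum]
  refine Finset.sum_congr rfl fun W _ => Finset.sum_congr rfl fun a _ =>
    Finset.sum_congr rfl fun b _ => ?_
  have e : entryUnit W a b (x W a b) =
      cornerHom W a (x W a b) * entryUnit (G := G) W a b (FullGroupCStar.elem 1) := by
    change _ = entryUnit W a a _ * _
    rw [entryUnit_mul, FullGroupCStar.elem_one, mul_one]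
  rw [e, map_mul, map_mul, h]
  exact congrArg (· * _) (DFunLike.congr_fun (hd W a) _)

end MatGroupSum

section MatGroupSumHom

variable {ω : Type} {k : ω → ℕ} {G : ω → Type} [∀ W, Group (G W)]

/-- The ⋆-homomorphism on matrices given by the "columns" `L a` and a representation of the
entries. -/
theorem exists_matrix_hom {k : ℕ} {G : Type} [Group G] {R : Type*} [NonUnitalCStarAlgebra R]
    (π : FullGroupCStar G →⋆ₙₐ[ℂ] R) (L : Fin k → R)
    (hL : ∀ a, star (L a) * L a = π 1) (hL0 : ∀ a b, a ≠ b → star (L a) * L b = 0) :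
    ∃ l : CStarMatrix (Fin k) (Fin k) (FullGroupCStar G) →⋆ₙₐ[ℂ] R,
      ∀ M, l M = ∑ a, ∑ b, L a * π (M a b) * star (L b) := by
  have hmid : ∀ a b x c d y, L a * π x * star (L b) * (L c * π y * star (L d)) =
      if b = c then L a * π (x * y) * star (L d) else 0 := by
    intro a b x c d y
    have e : L a * π x * star (L b) * (L c * π y * star (L d)) =
        L a * π x * (star (L b) * L c) * π y * star (L d) := by simp only [mul_assoc]
    rw [e]
    split_ifs with h
    · rw [h, hL, mul_assoc (L a), ← map_mul, mul_one, mul_assoc (L a), ← map_mul]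
    · rw [hL0 b c h, mul_zero, zero_mul, zero_mul]
  refine ⟨{ toFun := fun M => ∑ a, ∑ b, L a * π (M a b) * star (L b)
            map_smul' := fun z M => ?_, map_zero' := ?_, map_add' := fun M M' => ?_
            map_mul' := fun M M' => ?_, map_star' := fun M => ?_ }, fun M => rfl⟩
  · simp [Finset.smul_sum, mul_smul_comm, smul_mul_assoc]
  · simp
  · simp [mul_add, add_mul, Finset.sum_add_distrib]
  · simp_rw [Finset.sum_mul, Finset.mul_sum, hmid]
    refine Finset.sum_congr rfl fun a _ => ?_
    simp only [CStarMatrix.mul_apply, map_sum, Finset.mul_sum, Finset.sum_mul]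
    rw [Finset.sum_comm (s := Finset.univ (α := Fin k)) (t := Finset.univ (α := Fin k))
      (f := fun d b => L a * π (M a b * M' b d) * star (L d))]
    refine Finset.sum_congr rfl fun b _ => ?_
    refine Eq.trans ?_ (Finset.sum_eq_single b (fun c _ hc => by simp [hc.symm]) (by simp)).symm
    simp
  · rw [star_sum, Finset.sum_comm]
    refine Finset.sum_congr rfl fun a _ => ?_
    rw [star_sum]
    refine Finset.sum_congr rfl fun b _ => ?_
    rw [star_mul, star_mul, star_star, ← map_star, ← mul_assoc, CStarMatrix.star_apply]

/-- The ⋆-homomorphism on `⊕_W M_{k W}(C⋆(G W))` given by orthogonal "columns" `L p` and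
representations of the entries. -/
theorem exists_matGroupSum_hom [Fintype ω] [DecidableEq ω] {R : Type*} [NonUnitalCStarAlgebra R]
    (π : ∀ W, FullGroupCStar (G W) →⋆ₙₐ[ℂ] R) (L : (Σ W, Fin (k W)) → R)
    (hL : ∀ p, star (L p) * L p = π p.1 1) (hL0 : ∀ p q, p ≠ q → star (L p) * L q = 0) :
    ∃ l : MatGroupSum k G →⋆ₙₐ[ℂ] R, ∀ W a b x,
      l (entryUnit W a b x) = L ⟨W, a⟩ * π W x * star (L ⟨W, b⟩) := by
  choose l hl using fun W => exists_matrix_hom (π W) (fun a => L ⟨W, a⟩) (fun a => hL ⟨W, a⟩)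
    fun a b hab => hL0 _ _ fun h => hab (eq_of_heq (Sigma.mk.inj h).2)
  have h0 : ∀ W W', W ≠ W' → ∀ M M', l W M * l W' M' = 0 := by
    intro W W' hW M M'
    rw [hl, hl, Finset.sum_mul_sum]
    refine Finset.sum_eq_zero fun a _ => Finset.sum_eq_zero fun c _ => ?_
    rw [Finset.sum_mul_sum]
    refine Finset.sum_eq_zero fun b _ => Finset.sum_eq_zero fun d _ => ?_
    have e : ∀ u v x y z w : R, u * v * x * (y * z * w) = u * v * (x * y) * z * w := by
      intros; simp only [mul_assoc]
    rw [e, hL0 _ _ fun h => hW (Sigma.mk.inj h).1, mul_zero, zero_mul, zero_mul]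
  refine ⟨{ toFun := fun M => ∑ W, l W (M W)
            map_smul' := fun z M => ?_, map_zero' := ?_, map_add' := fun M M' => ?_
            map_mul' := fun M M' => ?_, map_star' := fun M => ?_ }, fun W a b x => ?_⟩
  · simp [Finset.smul_sum]
  · simp
  · simp [Finset.sum_add_distrib]
  · rw [Finset.sum_mul_sum]
    refine Finset.sum_congr rfl fun W _ => ?_
    rw [Finset.sum_eq_single W (fun W' _ h => h0 _ _ h.symm _ _) (by simp), ← map_mul]
    rfl
  · simp [map_star]
  · change ∑ V, l V (entryUnit (G := G) W a b x V) = _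
    rw [Finset.sum_eq_single W, entryUnit, Pi.single_eq_same, hl, Finset.sum_eq_single a,
      Finset.sum_eq_single b]
    · rw [CStarMatrix.ofMatrix_apply, Matrix.single_apply_same]
    · intro d _ hd
      rw [CStarMatrix.ofMatrix_apply, Matrix.single_apply_of_col_ne _ _ hd.symm, map_zero, mul_zero,
        zero_mul]
    · simp
    · intro d _ hd
      refine Finset.sum_eq_zero fun d' _ => ?_
      rw [CStarMatrix.ofMatrix_apply, Matrix.single_apply_of_row_ne hd.symm, map_zero, mul_zero,
        zero_mul]
    · simp
    · intro V _ hV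
      rw [entryUnit, Pi.single_eq_of_ne hV, map_zero]
    · simp

variable {r N : ℕ} {m : Fin r → ℕ}

/-- The element of `⊕_W M_{k W}(C⋆(G W))` whose entry in row `p` and column `q` of a summand is the
entry of `x` in row `ε p` and column `ε q` times `c p * (c q)⁻¹`. -/
noncomputable def gaugeFun (γ : Fin N ≃ DiagUnit m) (ε : (Σ W, Fin (k W)) ≃ Fin N)
    (c : ∀ W, Fin (k W) → G W) (x : MatSum m) : MatGroupSum k G := fun W =>
  CStarMatrix.ofMatrix fun a b =>
    entry γ x (ε ⟨W, a⟩) (ε ⟨W, b⟩) • FullGroupCStar.elem (c W a * (c W b)⁻¹)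

theorem gaugeFun_apply (γ : Fin N ≃ DiagUnit m) (ε : (Σ W, Fin (k W)) ≃ Fin N)
    (c : ∀ W, Fin (k W) → G W) (x : MatSum m) (W : ω) (a b : Fin (k W)) :
    gaugeFun γ ε c x W a b =
      entry γ x (ε ⟨W, a⟩) (ε ⟨W, b⟩) • FullGroupCStar.elem (c W a * (c W b)⁻¹) := rfl

/-- The ⋆-homomorphism `⊕ᵢ M_{m i} → ⊕_W M_{k W}(C⋆(G W))` that sends the matrix unit in row `ε p`
and column `ε q` to the matrix unit in row `p` and column `q`, with coefficient `c p * (c q)⁻¹`.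
By `hγ`, rows of the same `M_{m i}` belong to the same summand `W`. -/
noncomputable def gaugeEmb [Fintype ω] (γ : Fin N ≃ DiagUnit m) (ε : (Σ W, Fin (k W)) ≃ Fin N)
    (hγ : ∀ p q, (γ (ε p)).1 = (γ (ε q)).1 → p.1 = q.1) (c : ∀ W, Fin (k W) → G W) :
    MatSum m →⋆ₙₐ[ℂ] MatGroupSum k G where
  toFun := gaugeFun γ ε c
  map_smul' z x := by
    funext W; ext a b
    simp [gaugeFun_apply, entry_smul, mul_smul]
  map_zero' := by
    funext W; ext a b
    simp [gaugeFun_apply, entry_zero]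
  map_add' x y := by
    funext W; ext a b
    simp [gaugeFun_apply, entry_add, add_smul]
  map_mul' x y := by
    funext W; ext a b
    have hs : entry γ (x * y) (ε ⟨W, a⟩) (ε ⟨W, b⟩) =
        ∑ d, entry γ x (ε ⟨W, a⟩) (ε ⟨W, d⟩) * entry γ y (ε ⟨W, d⟩) (ε ⟨W, b⟩) := by
      rw [entry_mul, ← ε.sum_comp, Fintype.sum_sigma]
      refine Fintype.sum_eq_single W fun V hV => Finset.sum_eq_zero fun d _ => ?_
      rw [entry_of_ne γ x (fun h => hV (hγ _ _ h).symm), zero_mul]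
    rw [Pi.mul_apply, CStarMatrix.mul_apply]
    simp only [gaugeFun_apply, hs, Finset.sum_smul]
    refine Finset.sum_congr rfl fun d _ => ?_
    rw [smul_mul_smul_comm, ← FullGroupCStar.elem_mul, mul_assoc, inv_mul_cancel_left]
  map_star' x := by
    funext W; ext a b
    rw [Pi.star_apply, CStarMatrix.star_apply]
    simp only [gaugeFun_apply, star_smul, entry_star, FullGroupCStar.star_elem, mul_inv_rev,
      inv_inv]

variable [Fintype ω] {γ : Fin N ≃ DiagUnit m} {ε : (Σ W, Fin (k W)) ≃ Fin N}
    {hγ : ∀ p q, (γ (ε p)).1 = (γ (ε q)).1 → p.1 = q.1} {c : ∀ W, Fin (k W) → G W}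

theorem gaugeEmb_matUnit [DecidableEq ω] {W : ω} {a b : Fin (k W)}
    (h : (γ (ε ⟨W, a⟩)).1 = (γ (ε ⟨W, b⟩)).1) :
    gaugeEmb γ ε hγ c (matUnit γ (ε ⟨W, a⟩) (ε ⟨W, b⟩)) =
      entryUnit W a b (FullGroupCStar.elem (c W a * (c W b)⁻¹)) := by
  funext V; ext a' b'
  change entry γ _ (ε ⟨V, a'⟩) (ε ⟨V, b'⟩) • FullGroupCStar.elem (c V a' * (c V b')⁻¹) = _
  rw [entry_matUnit]
  by_cases hV : V = W
  · subst hV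
    rw [entryUnit, Pi.single_eq_same, CStarMatrix.ofMatrix_apply, Matrix.single_apply]
    by_cases h' : a = a' ∧ b = b'
    · obtain ⟨rfl, rfl⟩ := h'
      simp [h]
    · rw [if_neg h', if_neg, zero_smul]
      simpa using fun _ => not_and.1 h'
  · rw [entryUnit, Pi.single_eq_of_ne hV, if_neg, zero_smul]
    · rfl
    · rintro ⟨-, h', -⟩
      exact hV (Sigma.mk.inj (ε.injective h')).1.symm

/-- On diagonal matrices the gauge cancels. -/
theorem gaugeEmb_comp_diagEmb {r' : ℕ} {m' : Fin r' → ℕ} (γ : Fin N ≃ DiagUnit m)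
    (γ' : Fin N ≃ DiagUnit m') (ε : (Σ W, Fin (k W)) ≃ Fin N)
    (hγ : ∀ p q, (γ (ε p)).1 = (γ (ε q)).1 → p.1 = q.1)
    (hγ' : ∀ p q, (γ' (ε p)).1 = (γ' (ε q)).1 → p.1 = q.1) (c c' : ∀ W, Fin (k W) → G W) :
    (gaugeEmb γ ε hγ c).comp (diagEmb γ) = (gaugeEmb γ' ε hγ' c').comp (diagEmb γ') := by
  ext z W a b
  change gaugeFun γ ε c (diagEmb γ z) W a b = gaugeFun γ' ε c' (diagEmb γ' z) W a b
  rw [gaugeFun_apply, gaugeFun_apply, entry_diagEmb, entry_diagEmb]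
  by_cases h : a = b
  · rw [h, mul_inv_cancel, mul_inv_cancel]
  · rw [if_neg (by simpa using h), zero_smul, zero_smul]

end MatGroupSumHom

/-! ### Trivializing two systems of matrix units along a spanning forest -/

section PartialIsometry

variable {R : Type*} [NonUnitalCStarAlgebra R]

/-- `x` is a partial isometry with source `q` and range `p`. -/
structure IsIsometryBetween (p x q : R) : Prop where
  star_mul_self : star x * x = q
  mul_star_self : x * star x = p
  range_mul : p * x = x

namespace IsIsometryBetween

variable {p x q y t : R}

theorem mul_source (h : IsIsometryBetween p x q) : x * q = x := by
  rw [← h.star_mul_self, ← mul_assoc, h.mul_star_self, h.range_mul]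

theorem star (h : IsIsometryBetween p x q) : IsIsometryBetween q (star x) p where
  star_mul_self := by rw [star_star, h.mul_star_self]
  mul_star_self := by rw [star_star, h.star_mul_self]
  range_mul := by
    have hq : Star.star q = q := by rw [← h.star_mul_self, star_mul, star_star]
    simpa only [star_mul, hq] using congrArg Star.star h.mul_source

theorem mul (h : IsIsometryBetween p x q) (h' : IsIsometryBetween q y t) :
    IsIsometryBetween p (x * y) t where
  star_mul_self := by
    rw [star_mul, mul_assoc, ← mul_assoc (Star.star x), h.star_mul_self, h'.range_mul,
      h'.star_mul_self]
  mul_star_self := by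
    rw [star_mul, mul_assoc, ← mul_assoc y, h'.mul_star_self, h.star.range_mul, h.mul_star_self]
  range_mul := by rw [← mul_assoc, h.range_mul]

theorem isStarProjection (h : IsIsometryBetween p x q) : IsStarProjection q where
  isIdempotentElem := by
    rw [IsIdempotentElem]
    nth_rw 1 [← h.star_mul_self]
    rw [mul_assoc, h.mul_source, h.star_mul_self]
  isSelfAdjoint := by rw [← h.star_mul_self]; exact .star_mul_self x

end IsIsometryBetween

/-- `P` is a system of matrix units, whose unit `P e f` matters if `e` and `f` have the same image
under `v`. -/
structure IsMatrixUnits {N : ℕ} {I : Type*} (v : Fin N → I) (P : Fin N → Fin N → R) : Prop where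
  mul : ∀ {e f g}, v e = v f → v f = v g → P e f * P f g = P e g
  star : ∀ e f, star (P e f) = P f e
  orthogonal : ∀ {e f}, e ≠ f → P e e * P f f = 0

theorem IsMatrixUnits.isIsometryBetween {N : ℕ} {I : Type*} {v : Fin N → I}
    {P : Fin N → Fin N → R} (hP : IsMatrixUnits v P) {e f : Fin N} (h : v e = v f) :
    IsIsometryBetween (P e e) (P e f) (P f f) where
  star_mul_self := by rw [hP.star, hP.mul h.symm h]
  mul_star_self := by rw [hP.star, hP.mul h h.symm]
  range_mul := hP.mul rfl h

end PartialIsometry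

theorem isMatrixUnits_map {r N : ℕ} {m : Fin r → ℕ} (γ : Fin N ≃ DiagUnit m) {R : Type*}
    [NonUnitalCStarAlgebra R] (φ : MatSum m →⋆ₙₐ[ℂ] R) :
    IsMatrixUnits (fun e => (γ e).1) fun e f => φ (matUnit γ e f) where
  mul h h' := by rw [← map_mul, matUnit_mul h h']
  star e f := by rw [← map_star, star_matUnit]
  orthogonal h := by rw [← map_mul, matUnit_mul_of_ne h, map_zero]

section Trivialization

variable {r s N : ℕ} {m : Fin r → ℕ} {n : Fin s → ℕ}
  {α : Fin N ≃ DiagUnit m} {β : Fin N ≃ DiagUnit n}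
  {R : Type*} [NonUnitalCStarAlgebra R] {P Q : Fin N → Fin N → R}

/-- The component of an edge. -/
def edgeComponent (α : Fin N ≃ DiagUnit m) (β : Fin N ≃ DiagUnit n) (e : Fin N) : Component α β :=
  componentOf α β (Sum.inl (α e).1)

theorem edgeComponent_eq_of_fst_eq {e f : Fin N} (h : (α e).1 = (α f).1) :
    edgeComponent α β e = edgeComponent α β f := by
  rw [edgeComponent, h]; rfl

theorem edgeComponent_eq_of_snd_eq {e f : Fin N} (h : (β e).1 = (β f).1) :
    edgeComponent α β e = edgeComponent α β f := by
  rw [edgeComponent, edgeComponent, componentOf_inl_eq_inr, componentOf_inl_eq_inr, h]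

/-- Partial isometries `L e`, from a projection `ρ W` that depends on the component of `e` only to
`P e e`, which turn all units `P e f`, and the units `Q e f` for `e`, `f` in `F`, into
`L e * star (L f)`. -/
structure IsTrivialization (P Q : Fin N → Fin N → R) (F : Set (Fin N)) (ρ : Component α β → R)
    (L : Fin N → R) : Prop where
  isometry : ∀ e, IsIsometryBetween (P e e) (L e) (ρ (edgeComponent α β e))
  left : ∀ {e f}, (α e).1 = (α f).1 → L e = P e f * L f
  right : ∀ {e f}, e ∈ F → f ∈ F → (β e).1 = (β f).1 → L e = Q e f * L f

/-- The diagonal units `P e e` for the edges `e` of one component are equivalent projections. -/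
theorem exists_isIsometryBetween (hP : IsMatrixUnits (fun e => (α e).1) P)
    (hQ : IsMatrixUnits (fun e => (β e).1) Q) (hPQ : ∀ e, P e e = Q e e) {b e : Fin N}
    (hbe : edgeComponent α β b = edgeComponent α β e) :
    ∃ x, IsIsometryBetween (P e e) x (P b b) := by
  let p : Fin r ⊕ Fin s → Prop := fun y => ∀ e, Sum.inl (α e).1 = y ∨ Sum.inr (β e).1 = y →
    ∃ x, IsIsometryBetween (P e e) x (P b b)
  refine reachable_induction (p := p) (componentOf_eq_iff.1 hbe) ?_ ?_ ?_ e (Or.inl rfl)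
  · rintro e (he | he)
    · exact ⟨P e b, hP.isIsometryBetween (Sum.inl.inj he)⟩
    · exact (Sum.inr_ne_inl he).elim
  · rintro f - hf e (he | he)
    · exact (Sum.inl_ne_inr he).elim
    · obtain ⟨x, hx⟩ := hf f (Or.inl rfl)
      have hQx := hQ.isIsometryBetween (Sum.inr.inj he)
      rw [← hPQ, ← hPQ] at hQx
      exact ⟨Q e f * x, hQx.mul hx⟩
  · rintro f - hf e (he | he)
    · obtain ⟨x, hx⟩ := hf f (Or.inr rfl)
      exact ⟨P e f * x, (hP.isIsometryBetween (Sum.inl.inj he)).mul hx⟩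
    · exact (Sum.inr_ne_inl he).elim

theorem exists_isTrivialization_empty (hP : IsMatrixUnits (fun e => (α e).1) P)
    (hQ : IsMatrixUnits (fun e => (β e).1) Q) (hPQ : ∀ e, P e e = Q e e) :
    ∃ (ρ : Component α β → R) (L : Fin N → R), (∀ W, IsStarProjection (ρ W)) ∧
      IsTrivialization P Q ∅ ρ L := by
  have hρ (W : Component α β) : ∃ ρ : R, IsStarProjection ρ ∧
      ∀ e, edgeComponent α β e = W → ∃ x, IsIsometryBetween (P e e) x ρ := by
    by_cases h : ∃ b, edgeComponent α β b = W
    · obtain ⟨b, rfl⟩ := h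
      exact ⟨P b b, (hP.isIsometryBetween (e := b) rfl).isStarProjection,
        fun e he => exists_isIsometryBetween hP hQ hPQ he.symm⟩
    · exact ⟨0, .zero _, fun e he => (h ⟨e, he⟩).elim⟩
  choose ρ hρ hx using hρ
  choose V hV using fun e => hx _ e rfl
  -- a reference edge `rep e` at each vertex of the first kind
  let rep : Fin N → Fin N := fun e => (Quotient.mk (Setoid.ker fun e => (α e).1) e).out
  have hrep (e : Fin N) : (α e).1 = (α (rep e)).1 :=
    (Quotient.exact (Quotient.out_eq (Quotient.mk (Setoid.ker fun e => (α e).1) e))).symm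
  have hrep' {e f : Fin N} (h : (α e).1 = (α f).1) : rep e = rep f :=
    congrArg Quotient.out (Quotient.sound h)
  refine ⟨ρ, fun e => P e (rep e) * V (rep e), hρ, fun e => ?_, fun {e f} h => ?_,
    fun h => h.elim⟩
  · rw [edgeComponent_eq_of_fst_eq (hrep e)]
    exact (hP.isIsometryBetween (hrep e)).mul (hV (rep e))
  · rw [← mul_assoc, ← hrep' h, hP.mul h (h.symm.trans (hrep e))]

/-- Over the edges of a forest a trivialization exists. An additional edge joins two different
components of the smaller forest, and the `L g` on one of the two sides may be multiplied from the
right by the unitary of the corner of `ρ` that makes the units of the additional edge match. -/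
theorem exists_isTrivialization (hP : IsMatrixUnits (fun e => (α e).1) P)
    (hQ : IsMatrixUnits (fun e => (β e).1) Q) (hPQ : ∀ e, P e e = Q e e) {T : Set (Fin N)}
    (hT : IsSpanningForest α β T) :
    ∃ (ρ : Component α β → R) (L : Fin N → R), (∀ W, IsStarProjection (ρ W)) ∧
      IsTrivialization P Q T ρ L := by
  obtain ⟨ρ, L₀, hρ, hL₀⟩ := exists_isTrivialization_empty hP hQ hPQ
  suffices h : ∃ L, IsTrivialization P Q T ρ L from ⟨ρ, h.choose, hρ, h.choose_spec⟩
  refine Set.Finite.induction_on_subset (motive := fun F _ => ∃ L, IsTrivialization P Q F ρ L)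
    T T.toFinite ⟨L₀, hL₀⟩ ?_
  rintro e F heT hFT heF ⟨L, hL⟩
  have hself {g : Fin N} {x t : R} (h : IsIsometryBetween (P g g) x t) : x = Q g g * x := by
    rw [← hPQ, h.range_mul]
  by_cases hf : ∃ f ∈ F, (β f).1 = (β e).1
  swap
  · refine ⟨L, hL.isometry, hL.left, ?_⟩
    rintro g g' (rfl | hg) (rfl | hg') h
    · exact hself (hL.isometry _)
    · exact (hf ⟨g', hg', h.symm⟩).elim
    · exact (hf ⟨g, hg, h⟩).elim
    · exact hL.right hg hg' h
  obtain ⟨f, hfF, hfe⟩ := hf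
  have hcut : ¬ (adjGraph α β F).Reachable (Sum.inl (α e).1) (Sum.inr (β e).1) := fun h =>
    hT.bridge e heT (h.mono (adjGraph_mono fun g hg => ⟨hFT hg, fun hge => heF (hge ▸ hg)⟩))
  have hu : IsIsometryBetween (ρ (edgeComponent α β e)) (star (L f) * Q f e * L e)
      (ρ (edgeComponent α β e)) := by
    have h1 := (hL.isometry f).star
    rw [edgeComponent_eq_of_snd_eq hfe] at h1
    have h2 := hQ.isIsometryBetween hfe
    rw [← hPQ, ← hPQ] at h2
    exact (h1.mul h2).mul (hL.isometry e)
  set u := star (L f) * Q f e * L e with hu_def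
  -- the edge `e` and the vertex `β e` lie on different sides
  let S : Fin N → Prop := fun g =>
    (adjGraph α β F).Reachable (Sum.inl (α g).1) (Sum.inr (β e).1)
  have hS {g : Fin N} (hg : g ∈ F) (h : (β g).1 = (β e).1) : S g := by
    change (adjGraph α β F).Reachable _ _
    rw [← h]
    exact (adjGraph_adj hg).reachable
  have hS' {g g' : Fin N} (hg : g ∈ F) (hg' : g' ∈ F) (h : (β g).1 = (β g').1) : S g ↔ S g' := by
    have h1 : (adjGraph α β F).Reachable (Sum.inl (α g).1) (Sum.inl (α g').1) := by
      refine (adjGraph_adj hg).reachable.trans ?_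
      rw [h]
      exact (adjGraph_adj hg').reachable.symm
    exact ⟨fun h => h1.symm.trans h, fun h => h1.trans h⟩
  -- for edges of `F` at the vertex `β e` the new units match those of `e`
  have hmatch {g : Fin N} (hg : g ∈ F) (h : (β e).1 = (β g).1) : L e = Q e g * (L g * u) := by
    have h1 : L g = Q g f * L f := hL.right hg hfF (h.symm.trans hfe.symm)
    have h2 : Q e g * (L g * u) = Q e g * Q g f * (L f * star (L f)) * Q f e * L e := by
      rw [h1, hu_def]; simp only [mul_assoc]
    rw [h2, (hL.isometry f).mul_star_self, hPQ, hQ.mul h (h.symm.trans hfe.symm),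
      hQ.mul hfe.symm rfl, hQ.mul hfe.symm hfe]
    exact hself (hL.isometry e)
  clear_value u
  classical
  refine ⟨fun g => if S g then L g * u else L g, fun g => ?_, fun {g g'} h => ?_, ?_⟩
  · split_ifs with hg
    · have hc : edgeComponent α β g = edgeComponent α β e :=
        (componentOf_eq_iff.2 (hg.mono (adjGraph_mono (Set.subset_univ F)))).trans
          (componentOf_inl_eq_inr e).symm
      have h1 := hL.isometry g
      rw [hc] at h1 ⊢
      exact h1.mul hu
    · exact hL.isometry g
  · have hSS : S g ↔ S g' := by simp only [S, h]
    by_cases hg : S g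
    · rw [if_pos hg, if_pos (hSS.1 hg), ← mul_assoc, ← hL.left h]
    · rw [if_neg hg, if_neg (hSS.not.1 hg), ← hL.left h]
  · rintro g g' (rfl | hg) (rfl | hg') h
    · rw [if_neg (show ¬ S _ from hcut)]
      exact hself (hL.isometry _)
    · rw [if_neg (show ¬ S _ from hcut), if_pos (hS hg' h.symm)]
      exact hmatch hg' h
    · rw [if_neg (show ¬ S g' from hcut), if_pos (hS hg h), hmatch hg h.symm,
        ← mul_assoc (Q g g'), hQ.mul h h.symm, ← mul_assoc (Q g g), ← hself (hL.isometry g)]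
    · by_cases hgS : S g
      · rw [if_pos hgS, if_pos ((hS' hg hg' h).1 hgS), ← mul_assoc, ← hL.right hg hg' h]
      · rw [if_neg hgS, if_neg ((hS' hg hg' h).not.1 hgS), ← hL.right hg hg' h]

end Trivialization

/-! ### The universal pair of embeddings -/

section Universal

variable {r s N : ℕ} {m : Fin r → ℕ} {n : Fin s → ℕ}
  {α : Fin N ≃ DiagUnit m} {β : Fin N ≃ DiagUnit n}

/-- An enumeration of the edges, component by component. -/
noncomputable def edgeEquiv (α : Fin N ≃ DiagUnit m) (β : Fin N ≃ DiagUnit n) :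
    (Σ W : Component α β, Fin W.edges.ncard) ≃ Fin N :=
  (Equiv.sigmaCongrRight fun W : Component α β =>
    (Finite.equivFinOfCardEq (Nat.card_coe_set_eq W.edges)).symm).trans
    (Equiv.sigmaFiberEquiv (edgeComponent α β))

theorem edgeComponent_edgeEquiv (p : Σ W : Component α β, Fin W.edges.ncard) :
    edgeComponent α β (edgeEquiv α β p) = p.1 :=
  ((Finite.equivFinOfCardEq (Nat.card_coe_set_eq p.1.edges)).symm p.2).2

variable (F : Component α β → Set (Fin N))

/-- An enumeration of the edges of `W` outside `F W`. -/
noncomputable def restEquiv (W : Component α β) :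
    ↥(W.edges \ F W) ≃ Fin (W.edges \ F W).ncard :=
  Finite.equivFinOfCardEq (Nat.card_coe_set_eq _)

open Classical in
/-- The label of an edge in the free group: trivial in the spanning tree, and a free generator
outside it. -/
noncomputable def edgeLabel (W : Component α β) (a : Fin W.edges.ncard) :
    FreeGroup (Fin (W.edges \ F W).ncard) :=
  if h : edgeEquiv α β ⟨W, a⟩ ∈ W.edges \ F W then FreeGroup.of (restEquiv F W ⟨_, h⟩) else 1

/-- The embedding of the first algebra, without labels. -/
noncomputable def leftEmb : MatSum m →⋆ₙₐ[ℂ] FreeGroupMatSum F :=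
  gaugeEmb (ω := Component α β) (G := fun W => FreeGroup (Fin (W.edges \ F W).ncard))
    α (edgeEquiv α β)
    (fun p q h => by
      simpa only [edgeComponent_edgeEquiv] using edgeComponent_eq_of_fst_eq (β := β) h)
    fun _ _ => 1

/-- The embedding of the second algebra, with the edges labelled by `edgeLabel`. -/
noncomputable def rightEmb : MatSum n →⋆ₙₐ[ℂ] FreeGroupMatSum F :=
  gaugeEmb (ω := Component α β) (G := fun W => FreeGroup (Fin (W.edges \ F W).ncard))
    β (edgeEquiv α β)
    (fun p q h => by
      simpa only [edgeComponent_edgeEquiv] using edgeComponent_eq_of_snd_eq (α := α) h)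
    (edgeLabel F)

theorem leftEmb_comp_diagEmb : (leftEmb F).comp (diagEmb α) = (rightEmb F).comp (diagEmb β) :=
  gaugeEmb_comp_diagEmb ..

/-- The element of `FreeGroupMatSum F` with the only entry `g`, in row `a` and column `b` of the
summand `W`. -/
noncomputable def groupUnit (W : Component α β) (a b : Fin W.edges.ncard)
    (g : FreeGroup (Fin (W.edges \ F W).ncard)) : FreeGroupMatSum F :=
  haveI := Classical.decEq (Component α β)
  entryUnit (ω := Component α β) (G := fun W => FreeGroup (Fin (W.edges \ F W).ncard)) W a b
    (FullGroupCStar.elem g)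

variable {F}

theorem groupUnit_mul {W : Component α β} (a b d : Fin W.edges.ncard)
    (g h : FreeGroup (Fin (W.edges \ F W).ncard)) :
    groupUnit F W a b g * groupUnit F W b d h = groupUnit F W a d (g * h) := by
  let _ := Classical.decEq (Component α β)
  rw [groupUnit, groupUnit, groupUnit, FullGroupCStar.elem_mul]
  exact entryUnit_mul ..

theorem star_groupUnit {W : Component α β} (a b : Fin W.edges.ncard)
    (g : FreeGroup (Fin (W.edges \ F W).ncard)) :
    star (groupUnit F W a b g) = groupUnit F W b a g⁻¹ := by
  let _ := Classical.decEq (Component α β)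
  rw [groupUnit, groupUnit, ← FullGroupCStar.star_elem]
  exact star_entryUnit ..

theorem leftEmb_matUnit {W : Component α β} {a b : Fin W.edges.ncard}
    (h : (α (edgeEquiv α β ⟨W, a⟩)).1 = (α (edgeEquiv α β ⟨W, b⟩)).1) :
    leftEmb F (matUnit α (edgeEquiv α β ⟨W, a⟩) (edgeEquiv α β ⟨W, b⟩)) =
      groupUnit F W a b 1 := by
  classical
  refine (gaugeEmb_matUnit h).trans ?_
  rw [inv_one, mul_one, groupUnit]

theorem rightEmb_matUnit {W : Component α β} {a b : Fin W.edges.ncard}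
    (h : (β (edgeEquiv α β ⟨W, a⟩)).1 = (β (edgeEquiv α β ⟨W, b⟩)).1) :
    rightEmb F (matUnit β (edgeEquiv α β ⟨W, a⟩) (edgeEquiv α β ⟨W, b⟩)) =
      groupUnit F W a b (edgeLabel F W a * (edgeLabel F W b)⁻¹) := by
  classical
  refine (gaugeEmb_matUnit h).trans ?_
  rw [groupUnit]

theorem exists_edgeEquiv_eq {e f : Fin N} (h : edgeComponent α β e = edgeComponent α β f) :
    ∃ (W : Component α β) (a b : Fin W.edges.ncard),
      edgeEquiv α β ⟨W, a⟩ = e ∧ edgeEquiv α β ⟨W, b⟩ = f := by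
  obtain ⟨⟨W, a⟩, rfl⟩ := (edgeEquiv α β).surjective e
  obtain ⟨⟨W', b⟩, rfl⟩ := (edgeEquiv α β).surjective f
  rw [edgeComponent_edgeEquiv, edgeComponent_edgeEquiv] at h
  obtain rfl : W = W' := h
  exact ⟨W, a, b, rfl, rfl⟩

theorem edgeEquiv_mem_edges (W : Component α β) (a : Fin W.edges.ncard) :
    edgeEquiv α β ⟨W, a⟩ ∈ W.edges :=
  edgeComponent_edgeEquiv ⟨W, a⟩

variable {R : Type*} [NonUnitalCStarAlgebra R]

/-- The images of the two embeddings generate. Connectedness of the spanning trees yields the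
matrix units, and the labels of the remaining edges yield the free generators. -/
theorem hom_eq_of_comp_eq (hF : ∀ W : Component α β, W.IsSpanningTree (F W))
    {l l' : FreeGroupMatSum F →⋆ₙₐ[ℂ] R} (h₁ : l.comp (leftEmb F) = l'.comp (leftEmb F))
    (h₂ : l.comp (rightEmb F) = l'.comp (rightEmb F)) : l = l' := by
  have hT := isSpanningForest_iUnion hF
  let A (W : Component α β) (a b : Fin W.edges.ncard)
    (g : FreeGroup (Fin (W.edges \ F W).ncard)) : Prop :=
    l (groupUnit F W a b g) = l' (groupUnit F W a b g)
  have hmul {W} {a b d : Fin W.edges.ncard} {g h} (hab : A W a b g) (hbd : A W b d h) :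
      A W a d (g * h) := by
    change l _ = l' _
    rw [← groupUnit_mul a b d, map_mul, map_mul, hab, hbd]
  have hstar {W} {a b : Fin W.edges.ncard} {g} (hab : A W a b g) : A W b a g⁻¹ := by
    change l _ = l' _
    rw [← star_groupUnit, map_star, map_star, hab]
  have hα {W} {a b : Fin W.edges.ncard}
      (h : (α (edgeEquiv α β ⟨W, a⟩)).1 = (α (edgeEquiv α β ⟨W, b⟩)).1) : A W a b 1 := by
    change l _ = l' _
    rw [← leftEmb_matUnit h]
    exact DFunLike.congr_fun h₁ _
  have hβ {W} {a b : Fin W.edges.ncard}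
      (h : (β (edgeEquiv α β ⟨W, a⟩)).1 = (β (edgeEquiv α β ⟨W, b⟩)).1) :
      A W a b (edgeLabel F W a * (edgeLabel F W b)⁻¹) := by
    change l _ = l' _
    rw [← rightEmb_matUnit h]
    exact DFunLike.congr_fun h₂ _
  have hlab {W} {a : Fin W.edges.ncard} (h : edgeEquiv α β ⟨W, a⟩ ∈ ⋃ W, F W) :
      edgeLabel F W a = 1 :=
    dif_neg fun h' => h'.2 ((mem_iUnion_isSpanningTree hF h'.1).1 h)
  have hone {W} (a b : Fin W.edges.ncard) : A W a b 1 := by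
    let p : Fin r ⊕ Fin s → Prop := fun y => ∀ a : Fin W.edges.ncard,
      Sum.inl (α (edgeEquiv α β ⟨W, a⟩)).1 = y ∨
        Sum.inr (β (edgeEquiv α β ⟨W, a⟩)).1 = y ∧ edgeEquiv α β ⟨W, a⟩ ∈ ⋃ W, F W → A W a b 1
    refine reachable_induction (p := p) (hT.connects (Sum.inl (α (edgeEquiv α β ⟨W, b⟩)).1) _
      ((edgeEquiv_mem_edges W b).trans (edgeEquiv_mem_edges W a).symm)) ?_ ?_ ?_ a (Or.inl rfl)
    · rintro d (hd | ⟨hd, -⟩)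
      · exact hα (Sum.inl.inj hd)
      · exact (Sum.inr_ne_inl hd).elim
    · rintro f hfT hf d (hd | ⟨hd, hdT⟩)
      · exact (Sum.inl_ne_inr hd).elim
      · have hd := Sum.inr.inj hd
        obtain ⟨⟨W', f⟩, rfl⟩ := (edgeEquiv α β).surjective f
        obtain rfl : W = W' := by
          simpa only [edgeComponent_edgeEquiv] using edgeComponent_eq_of_snd_eq (α := α) hd
        have := hmul (hβ hd) (hf f (Or.inl rfl))
        rwa [hlab hdT, hlab hfT, inv_one, mul_one, mul_one] at this
    · rintro f hfT hf d (hd | ⟨hd, -⟩)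
      · have hd := Sum.inl.inj hd
        obtain ⟨⟨W', f⟩, rfl⟩ := (edgeEquiv α β).surjective f
        obtain rfl : W = W' := by
          simpa only [edgeComponent_edgeEquiv] using edgeComponent_eq_of_fst_eq (β := β) hd
        have := hmul (hα hd) (hf f (Or.inr ⟨rfl, hfT⟩))
        rwa [mul_one] at this
      · exact (Sum.inr_ne_inl hd).elim
  have hlabel {W} (a : Fin W.edges.ncard) : A W a a (edgeLabel F W a) := by
    obtain ⟨f, hfT, hf⟩ := hT.exists_mem (edgeEquiv α β ⟨W, a⟩)
    obtain ⟨⟨W', f⟩, rfl⟩ := (edgeEquiv α β).surjective f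
    obtain rfl : W = W' := by
      simpa only [edgeComponent_edgeEquiv] using (edgeComponent_eq_of_snd_eq (α := α) hf).symm
    have := hmul (hβ hf.symm) (hone f a)
    rwa [hlab hfT, inv_one, mul_one, mul_one] at this
  have hgroup {W} (b : Fin W.edges.ncard) (g) : A W b b g := by
    induction g using FreeGroup.induction_on with
    | C1 => exact hone b b
    | of j =>
      obtain ⟨⟨e, he⟩, rfl⟩ := (restEquiv F W).surjective j
      obtain ⟨⟨W', a⟩, rfl⟩ := (edgeEquiv α β).surjective e
      obtain rfl : W' = W := (edgeComponent_edgeEquiv ⟨W', a⟩).symm.trans he.1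
      have := hmul (hmul (hone b a) (hlabel a)) (hone a b)
      rwa [one_mul, mul_one, edgeLabel, dif_pos he] at this
    | inv_of j hj => exact hstar hj
    | mul g h hg hh => exact hmul hg hh
  let _ := Classical.decEq (Component α β)
  refine matGroupSum_hom_ext (ω := Component α β) fun W a b g => ?_
  have := hmul (hgroup a g) (hone a b)
  rwa [mul_one] at this

/-- A pair of ⋆-homomorphisms that agree on the diagonal factors through `FreeGroupMatSum F`. In a
trivialization of the two systems of matrix units along the spanning forest, the edges outside the
forest give unitaries of the corners, and these define representations of the free groups. -/
theorem exists_hom_comp_eq (hF : ∀ W : Component α β, W.IsSpanningTree (F W))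
    (φ₁ : MatSum m →⋆ₙₐ[ℂ] R) (φ₂ : MatSum n →⋆ₙₐ[ℂ] R)
    (hφ : φ₁.comp (diagEmb α) = φ₂.comp (diagEmb β)) :
    ∃ l : FreeGroupMatSum F →⋆ₙₐ[ℂ] R, l.comp (leftEmb F) = φ₁ ∧ l.comp (rightEmb F) = φ₂ := by
  have hT := isSpanningForest_iUnion hF
  set P : Fin N → Fin N → R := fun e f => φ₁ (matUnit α e f)
  set Q : Fin N → Fin N → R := fun e f => φ₂ (matUnit β e f)
  have hP : IsMatrixUnits (fun e => (α e).1) P := isMatrixUnits_map α φ₁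
  have hQ : IsMatrixUnits (fun e => (β e).1) Q := isMatrixUnits_map β φ₂
  have hPQ (e : Fin N) : P e e = Q e e := by
    have := DFunLike.congr_fun hφ (Pi.single e 1)
    simpa only [NonUnitalStarAlgHom.comp_apply, diagEmb_single] using this
  obtain ⟨ρ, L, hρ, hL⟩ := exists_isTrivialization hP hQ hPQ hT
  choose t htT ht using hT.exists_mem
  let u : Fin N → R := fun e => star (L e) * Q e (t e) * L (t e)
  have hu {W : Component α β} {e : Fin N} (he : edgeComponent α β e = W) :
      ∃ x : CornerUnitary (ρ W) (hρ W), x.val = u e := by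
    have h1 := hQ.isIsometryBetween (ht e).symm
    rw [← hPQ, ← hPQ] at h1
    have h2 := ((hL.isometry e).star.mul h1).mul (hL.isometry (t e))
    rw [edgeComponent_eq_of_snd_eq (ht e), he] at h2
    exact ⟨⟨u e, h2.range_mul, h2.mul_source, h2.star_mul_self, h2.mul_star_self⟩, rfl⟩
  choose v hv using fun (W : Component α β) (j : Fin (W.edges \ F W).ncard) =>
    hu (W := W) ((restEquiv F W).symm j).2.1
  choose π hπ using fun W => FullGroupCStar.exists_hom_of_cornerUnitary (FreeGroup.lift (v W))
  have hπ1 (W : Component α β) : π W 1 = ρ W := by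
    rw [← FullGroupCStar.elem_one, hπ, map_one]; rfl
  have hQL (e : Fin N) : Q e e * L e = L e := by rw [← hPQ, (hL.isometry e).range_mul]
  have hπlabel (W : Component α β) (a : Fin W.edges.ncard) :
      π W (FullGroupCStar.elem (edgeLabel F W a)) = u (edgeEquiv α β ⟨W, a⟩) := by
    by_cases h : edgeEquiv α β ⟨W, a⟩ ∈ W.edges \ F W
    · rw [hπ, edgeLabel, dif_pos h, FreeGroup.lift_apply_of, hv, Equiv.symm_apply_apply]
    · have h1 : edgeEquiv α β ⟨W, a⟩ ∈ ⋃ W, F W :=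
        Set.mem_iUnion.2 ⟨W, not_not.1 fun h' => h ⟨edgeEquiv_mem_edges W a, h'⟩⟩
      rw [edgeLabel, dif_neg h, FullGroupCStar.elem_one, hπ1]
      simp only [u]
      rw [mul_assoc, ← hL.right h1 (htT _) (ht _).symm, (hL.isometry _).star_mul_self,
        edgeComponent_edgeEquiv]
  have hLu (e : Fin N) : L e * u e = Q e (t e) * L (t e) := by
    simp only [u]
    rw [← mul_assoc, ← mul_assoc, (hL.isometry e).mul_star_self, hPQ, hQ.mul rfl (ht e).symm]
  have hLu' (e : Fin N) : star (u e) * star (L e) = star (L (t e)) * Q (t e) e := by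
    rw [← star_mul, hLu, star_mul, hQ.star]
  let _ := Classical.decEq (Component α β)
  obtain ⟨l, hl⟩ := exists_matGroupSum_hom (ω := Component α β) π
    (fun p => L (edgeEquiv α β p))
    (fun p => by rw [(hL.isometry _).star_mul_self, edgeComponent_edgeEquiv, hπ1])
    fun p q hpq => by
      rw [← (hL.isometry (edgeEquiv α β p)).star.mul_source, mul_assoc,
        ← (hL.isometry (edgeEquiv α β q)).range_mul, ← mul_assoc (P _ _),
        hP.orthogonal ((edgeEquiv α β).injective.ne hpq), zero_mul, mul_zero]
  have hl' (W : Component α β) (a b : Fin W.edges.ncard) (g) : l (groupUnit F W a b g) =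
      L (edgeEquiv α β ⟨W, a⟩) * π W (FullGroupCStar.elem g) *
        star (L (edgeEquiv α β ⟨W, b⟩)) := hl ..
  refine ⟨l, matSum_hom_ext (γ := α) fun e f hef => ?_, matSum_hom_ext (γ := β) fun e f hef => ?_⟩
  · obtain ⟨W, a, b, rfl, rfl⟩ :=
      exists_edgeEquiv_eq (edgeComponent_eq_of_fst_eq (β := β) hef)
    rw [NonUnitalStarAlgHom.comp_apply, leftEmb_matUnit hef, hl', FullGroupCStar.elem_one, hπ1]
    have h1 := (hL.isometry (edgeEquiv α β ⟨W, a⟩)).mul_source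
    rw [edgeComponent_edgeEquiv] at h1
    rw [h1, hL.left hef, mul_assoc, (hL.isometry _).mul_star_self, hP.mul hef rfl]
  · obtain ⟨W, a, b, rfl, rfl⟩ :=
      exists_edgeEquiv_eq (edgeComponent_eq_of_snd_eq (α := α) hef)
    rw [NonUnitalStarAlgHom.comp_apply, rightEmb_matUnit hef, hl', FullGroupCStar.elem_mul,
      ← FullGroupCStar.star_elem, map_mul, map_star, hπlabel, hπlabel, ← mul_assoc, hLu, mul_assoc,
      hLu']
    set e := edgeEquiv α β ⟨W, a⟩
    set f := edgeEquiv α β ⟨W, b⟩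
    have hte : (β (t e)).1 = (β (t f)).1 := (ht e).trans (hef.trans (ht f).symm)
    rw [hL.right (htT e) (htT f) hte, mul_assoc, mul_assoc, ← mul_assoc (L (t f)),
      (hL.isometry _).mul_star_self, hPQ, hQ.mul rfl (ht f), hQ.mul hte (ht f),
      hQ.mul (ht e).symm ((ht e).trans hef)]

theorem isAmalgam_leftEmb_rightEmb.{v} (hF : ∀ W : Component α β, W.IsSpanningTree (F W)) :
    IsAmalgam.{v} (diagEmb α) (diagEmb β) (leftEmb F) (rightEmb F) where
  comm := leftEmb_comp_diagEmb F
  existsUnique_lift R _ φ₁ φ₂ hφ := by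
    obtain ⟨l, h₁, h₂⟩ := exists_hom_comp_eq hF φ₁ φ₂ hφ
    exact ⟨l, ⟨h₁, h₂⟩, fun l' h' =>
      hom_eq_of_comp_eq hF (h'.1.trans h₁.symm) (h'.2.trans h₂.symm)⟩

end Universal

/-- Amalgamated free products are unique up to isomorphism. -/
theorem IsAmalgam.nonempty_starAlgEquiv.{v} {D A B : Type*} {T S : Type v}
    [NonUnitalCStarAlgebra D] [NonUnitalCStarAlgebra A] [NonUnitalCStarAlgebra B]
    [NonUnitalCStarAlgebra T] [NonUnitalCStarAlgebra S] {i₁ : D →⋆ₙₐ[ℂ] A} {i₂ : D →⋆ₙₐ[ℂ] B}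
    {θ₁ : A →⋆ₙₐ[ℂ] T} {θ₂ : B →⋆ₙₐ[ℂ] T} {ψ₁ : A →⋆ₙₐ[ℂ] S} {ψ₂ : B →⋆ₙₐ[ℂ] S}
    (hT : IsAmalgam.{v} i₁ i₂ θ₁ θ₂) (hS : IsAmalgam.{v} i₁ i₂ ψ₁ ψ₂) :
    Nonempty (T ≃⋆ₐ[ℂ] S) := by
  obtain ⟨f, ⟨hf₁, hf₂⟩, -⟩ := hT.existsUnique_lift S ψ₁ ψ₂ hS.comm
  obtain ⟨g, ⟨hg₁, hg₂⟩, -⟩ := hS.existsUnique_lift T θ₁ θ₂ hT.comm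
  have hgf : g.comp f = .id ℂ T := (hT.existsUnique_lift T θ₁ θ₂ hT.comm).unique
    ⟨by rw [NonUnitalStarAlgHom.comp_assoc, hf₁, hg₁],
      by rw [NonUnitalStarAlgHom.comp_assoc, hf₂, hg₂]⟩
    ⟨NonUnitalStarAlgHom.id_comp _, NonUnitalStarAlgHom.id_comp _⟩
  have hfg : f.comp g = .id ℂ S := (hS.existsUnique_lift S ψ₁ ψ₂ hS.comm).unique
    ⟨by rw [NonUnitalStarAlgHom.comp_assoc, hg₁, hf₁],
      by rw [NonUnitalStarAlgHom.comp_assoc, hg₂, hf₂]⟩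
    ⟨NonUnitalStarAlgHom.id_comp _, NonUnitalStarAlgHom.id_comp _⟩
  exact ⟨{ f with
    invFun := g
    left_inv := DFunLike.congr_fun hgf
    right_inv := DFunLike.congr_fun hfg }⟩

end AmalgFD

theorem theorem3p1 {r s N : ℕ} (m : Fin r → ℕ) (n : Fin s → ℕ)
    (hm : ∑ i, m i = N) (hn : ∑ j, n j = N)
    (α : Fin N ≃ DiagUnit m) (β : Fin N ≃ DiagUnit n) :
    (∀ W : Component α β, ∃ F : Set (Fin N), W.IsSpanningTree F) ∧
    ∀ F : Component α β → Set (Fin N), (∀ W : Component α β, W.IsSpanningTree (F W)) →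
      (∃ (ψ₁ : MatSum m →⋆ₙₐ[ℂ] FreeGroupMatSum F) (ψ₂ : MatSum n →⋆ₙₐ[ℂ] FreeGroupMatSum F),
        IsAmalgam.{u} (diagEmb α) (diagEmb β) ψ₁ ψ₂) ∧
      ∀ (T : Type) [NonUnitalCStarAlgebra T] (θ₁ : MatSum m →⋆ₙₐ[ℂ] T) (θ₂ : MatSum n →⋆ₙₐ[ℂ] T),
        IsAmalgam.{0} (diagEmb α) (diagEmb β) θ₁ θ₂ →
          Nonempty (T ≃⋆ₐ[ℂ] FreeGroupMatSum F) :=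
  ⟨fun W => W.exists_isSpanningTree, fun F hF =>
    ⟨⟨leftEmb F, rightEmb F, isAmalgam_leftEmb_rightEmb hF⟩, fun _ _ _ _ hT =>
      hT.nonempty_starAlgEquiv (isAmalgam_leftEmb_rightEmb hF)⟩⟩
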